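/- **Proposition 3 (Case $(4,*)$).** Let $G$ be a 6-transposition group, that is, a group generated by a normal (conjugation-invariant) set $D$ of involutions such that $|gh|\le 6$ for all $g,h\in D$. Let $x,y,z\in D$ with $G=\langle x,y,z\rangle$, and suppose that $$(xy)^2=(xz)^4=(yz)^{r_2}=1\qquad\text{for some } r_2\in\{5,6\}.$$ Then $G$ is a quotient of one of the following groups, where $k^n$ denotes a direct product of $n$ cyclic groups of order $k$, $D_{2n}$ the dihedral group of order $2n$, and $N:H$ a semidirect product: 1. $2^{r_2}:D_{2r_2}$, where $D_{2r_2}$ permutes a basis of $2^{r_2}$ as it permutes the vertices of the regular $r_2$-gon; 2. $2\times(2^4:S_5)$, where $2^4$ is the group of subsets of even size of $\{1,\dots,5\}$ under symmetric difference, with the natural action of $S_5$; 3. $2\times(2^6:S_5)$, where $2^6$ is the cycle space over $\mathbb F_2$ of the complete graph $K_5$ (the subgraphs with all vertex degrees even), with the natural action of $S_5$; 4. $3^4:(D_8\times S_3)$, where $3^4=U\otimes V$ over $\mathbb F_3$, with $U$ the space of functions $u$ on the vertices of a square that satisfy $u(v')=-u(v)$ for opposite vertices $v,v'$ (acted on by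 $D_8$), and $V=\{w\in\mathbb F_3^3: w_1+w_2+w_3=0\}$ (acted on by $S_3$); 5. $(S_4\times S_4):2^2$, where one generator of $2^2$ interchanges the two factors $S_4$ and another acts trivially; 6. $(A_5\times A_5):2^2$, where one generator of $2^2$ interchanges the two factors $A_5$ and another conjugates both coordinates by the same transposition of $S_5$; 7. $PGL(2,9)$. -/

import Mathlib

namespace SixTransposition

/-- `D` is a set of 6-transpositions of `G`: a normal set of involutions generating `G` such that
the product of any two of its elements has (finite) order at most `6`. -/
structure IsSixTranspositionSet {G : Type*} [Group G] (D : Set G) : Prop where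
  closure_eq_top : Subgroup.closure D = ⊤
  conj_mem : ∀ g : G, ∀ d ∈ D, g * d * g⁻¹ ∈ D
  orderOf_eq_two : ∀ d ∈ D, orderOf d = 2
  isOfFinOrder_mul : ∀ a ∈ D, ∀ b ∈ D, IsOfFinOrder (a * b)
  orderOf_mul_le : ∀ a ∈ D, ∀ b ∈ D, orderOf (a * b) ≤ 6

/-- `G` is (isomorphic to) a quotient of `M`. -/
def IsQuotientOf (G M : Type*) [Group G] [Group M] : Prop :=
  ∃ f : M →* G, Function.Surjective f

/-- The cyclic group of order `k`, written multiplicatively. -/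
abbrev Cyc (k : ℕ) : Type := Multiplicative (ZMod k)

/-- The restriction of an action by automorphisms to an invariant subgroup. -/
def restrictAut {N H : Type*} [Group N] [Group H] (φ : H →* MulAut N) (K : Subgroup N)
    (hK : ∀ h : H, ∀ n ∈ K, φ h n ∈ K) : H →* MulAut K where
  toFun h :=
    { toFun := fun n => ⟨φ h n, hK h n n.2⟩
      invFun := fun n => ⟨φ h⁻¹ n, hK h⁻¹ n n.2⟩
      left_inv := fun n => by ext; simp
      right_inv := fun n => by ext; simp
      map_mul' := fun a b => by ext; simp }
  map_one' := by ext n; simp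
  map_mul' a b := by ext n; simp

/-- The action of the cyclic group of order two whose generator acts as `α`, where `α ^ 2 = 1`. -/
def involAut {N : Type*} [Group N] (α : MulAut N) (hα : α * α = 1) : Cyc 2 →* MulAut N where
  toFun c := α ^ (ZMod.val (Multiplicative.toAdd c))
  map_one' := by simp
  map_mul' a b := by
    have key : ∀ i j : ZMod 2,
        α ^ (ZMod.val (i + j)) = α ^ (ZMod.val i) * α ^ (ZMod.val j) := by
      intro i j
      rw [ZMod.val_add, ← pow_add]
      exact (pow_eq_pow_mod _ (by rw [pow_two, hα])).symm
    exact key _ _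

/-- The action of the dihedral group of order `2 * n` on the vertices of the regular `n`-gon,
labelled by `ZMod n`: `r i` is the rotation `k ↦ i + k`, and `sr i` is the reflection
`k ↦ -i - k`. -/
instance dihedralMulAction (n : ℕ) : MulAction (DihedralGroup n) (ZMod n) where
  smul g k := match g with
    | .r i => i + k
    | .sr i => -i - k
  one_smul k := zero_add k
  mul_smul g h k := by
    rcases g with i | i <;> rcases h with j | j
    · change i + j + k = i + (j + k); ring
    · change -(j - i) - k = i + (-j - k); ring
    · change -(i + j) - k = -i - (j + k); ring
    · change j - i + k = -i - (-j - k); ring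

/-- `2 ^ n : D_{2n}`: the dihedral group of order `2 * n` permutes a basis of the elementary
abelian group `2 ^ n` as it permutes the vertices of the regular `n`-gon. -/
abbrev TwoPowDihedral (n : ℕ) : Type :=
  (ZMod n → Cyc 2) ⋊[mulAutArrow (G := DihedralGroup n)] DihedralGroup n

/-- The elementary abelian group `2 ^ 4` of even subsets of a five-element set. -/
def evenSubsets : Subgroup (Fin 5 → Cyc 2) where
  carrier := {f | ∏ i, f i = 1}
  one_mem' := by simp
  mul_mem' := by
    intro f g hf hg
    simp only [Set.mem_ofPred_eq] at *
    simp [Finset.prod_mul_distrib, hf, hg]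
  inv_mem' := by
    intro f hf
    simp only [Set.mem_ofPred_eq] at *
    simp [hf]

theorem evenSubsets_invariant (σ : Equiv.Perm (Fin 5)) (f : Fin 5 → Cyc 2)
    (hf : f ∈ evenSubsets) : mulAutArrow σ f ∈ evenSubsets := by
  have h : ∏ i, f i = 1 := hf
  change ∏ i, f (σ⁻¹ i) = 1
  rw [← h]
  exact Equiv.prod_comp σ⁻¹ f

/-- `2 ^ 4 : S_5`, with `S_5` acting naturally on the even subsets of five points. -/
abbrev TwoPowFourSymm : Type :=
  evenSubsets ⋊[restrictAut mulAutArrow evenSubsets evenSubsets_invariant] Equiv.Perm (Fin 5)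

/-- The elementary abelian group `2 ^ 6` of even subgraphs (the cycle space) of the complete graph
on five vertices; a subgraph is given by its adjacency function, a symmetric function that is
trivial on the diagonal, and it is even if all its vertex degrees are even. -/
def evenSubgraphs : Subgroup (Fin 5 × Fin 5 → Cyc 2) where
  carrier := {f | (∀ i j, f (i, j) = f (j, i)) ∧ (∀ i, f (i, i) = 1) ∧ ∀ i, ∏ j, f (i, j) = 1}
  one_mem' := by simp
  mul_mem' := by
    rintro f g ⟨hf1, hf2, hf3⟩ ⟨hg1, hg2, hg3⟩
    refine ⟨fun i j => ?_, fun i => ?_, fun i => ?_⟩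
    · rw [Pi.mul_apply, Pi.mul_apply, hf1 i j, hg1 i j]
    · simp [hf2, hg2]
    · simp [Finset.prod_mul_distrib, hf3, hg3]
  inv_mem' := by
    rintro f ⟨hf1, hf2, hf3⟩
    refine ⟨fun i j => ?_, fun i => ?_, fun i => ?_⟩
    · rw [Pi.inv_apply, Pi.inv_apply, hf1 i j]
    · simp [hf2]
    · simp [hf3]

theorem evenSubgraphs_invariant (σ : Equiv.Perm (Fin 5)) (f : Fin 5 × Fin 5 → Cyc 2)
    (hf : f ∈ evenSubgraphs) : mulAutArrow σ f ∈ evenSubgraphs := by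
  obtain ⟨h1, h2, h3⟩ := hf
  refine ⟨fun i j => h1 _ _, fun i => h2 _, fun i => ?_⟩
  change ∏ j, f (σ⁻¹ i, σ⁻¹ j) = 1
  rw [← h3 (σ⁻¹ i)]
  exact Equiv.prod_comp σ⁻¹ fun j => f (σ⁻¹ i, j)

/-- `2 ^ 6 : S_5`, with `S_5` acting naturally on the even subgraphs of the complete graph on five
vertices. -/
abbrev TwoPowSixSymm : Type :=
  evenSubgraphs ⋊[restrictAut mulAutArrow evenSubgraphs evenSubgraphs_invariant]
    Equiv.Perm (Fin 5)

/-- The elementary abelian group `3 ^ 4`, as the tensor product of two planes over the field of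
three elements: the functions `u` on the vertices of the square with `u (k + 2) = - u k`, and the
functions on three points with sum zero. -/
def oddSumZero : Subgroup (ZMod 4 × Fin 3 → Cyc 3) where
  carrier := {f | (∀ k j, f (k + 2, j) = (f (k, j))⁻¹) ∧ ∀ k, ∏ j, f (k, j) = 1}
  one_mem' := by simp
  mul_mem' := by
    rintro f g ⟨hf1, hf2⟩ ⟨hg1, hg2⟩
    refine ⟨fun k j => ?_, fun k => ?_⟩
    · rw [Pi.mul_apply, Pi.mul_apply, hf1, hg1, mul_inv]
    · simp [Finset.prod_mul_distrib, hf2, hg2]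
  inv_mem' := by
    rintro f ⟨hf1, hf2⟩
    refine ⟨fun k j => ?_, fun k => ?_⟩
    · rw [Pi.inv_apply, Pi.inv_apply, hf1]
    · simp [hf2]

/-- `D_8 × S_3` acts on pairs (vertex of the square, one of three points) componentwise. -/
instance squareTriangleMulAction :
    MulAction (DihedralGroup 4 × Equiv.Perm (Fin 3)) (ZMod 4 × Fin 3) where
  smul g p := (g.1 • p.1, g.2 • p.2)
  one_smul p := by
    change ((1 : DihedralGroup 4) • p.1, (1 : Equiv.Perm (Fin 3)) • p.2) = p
    simp
  mul_smul g h p := by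
    change ((g.1 * h.1) • p.1, (g.2 * h.2) • p.2) = (g.1 • h.1 • p.1, g.2 • h.2 • p.2)
    rw [mul_smul, mul_smul]

theorem oddSumZero_invariant (g : DihedralGroup 4 × Equiv.Perm (Fin 3))
    (f : ZMod 4 × Fin 3 → Cyc 3) (hf : f ∈ oddSumZero) : mulAutArrow g f ∈ oddSumZero := by
  obtain ⟨h1, h2⟩ := hf
  have hd : ∀ (d : DihedralGroup 4) (k : ZMod 4), d • (k + 2) = d • k + 2 := by
    rintro (i | i) k
    · change i + (k + 2) = i + k + 2; ring
    · change -i - (k + 2) = -i - k + 2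
      have h4 : (4 : ZMod 4) = 0 := by decide
      linear_combination (-1 : ZMod 4) * h4
  refine ⟨fun k j => ?_, fun k => ?_⟩
  · change f (g⁻¹.1 • (k + 2), g⁻¹.2 • j) = (f (g⁻¹.1 • k, g⁻¹.2 • j))⁻¹
    rw [hd, h1]
  · change ∏ j, f (g⁻¹.1 • k, g⁻¹.2 j) = 1
    rw [← h2 (g⁻¹.1 • k)]
    exact Equiv.prod_comp g⁻¹.2 fun j => f (g⁻¹.1 • k, j)

/-- `3 ^ 4 : (D_8 × S_3)`, with the tensor product action on `3 ^ 4`. -/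
abbrev ThreePowFour : Type :=
  oddSumZero ⋊[restrictAut mulAutArrow oddSumZero oddSumZero_invariant]
    (DihedralGroup 4 × Equiv.Perm (Fin 3))

/-- The automorphism of `A × A` interchanging the two factors. -/
def swapAut (A : Type*) [Group A] : MulAut (A × A) := MulEquiv.prodComm

theorem swapAut_mul_self (A : Type*) [Group A] : swapAut A * swapAut A = 1 := by
  ext p <;> rfl

/-- `(S_4 × S_4) : 2 ^ 2`: the first factor of `2 ^ 2` interchanges the two copies of `S_4`, the
second one acts trivially. -/
abbrev SymmFourSq : Type :=
  (Equiv.Perm (Fin 4) × Equiv.Perm (Fin 4))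
    ⋊[(involAut (swapAut _) (swapAut_mul_self _)).comp (MonoidHom.fst (Cyc 2) (Cyc 2))]
      (Cyc 2 × Cyc 2)

/-- The automorphism of `A_5 × A_5` that conjugates both coordinates by the transposition
`(0 1)`. -/
def diagTranspositionAut : MulAut (alternatingGroup (Fin 5) × alternatingGroup (Fin 5)) :=
  MulEquiv.prodCongr (MulAut.conjNormal (Equiv.swap 0 1)) (MulAut.conjNormal (Equiv.swap 0 1))

theorem diagTranspositionAut_mul_self : diagTranspositionAut * diagTranspositionAut = 1 := by
  have h : (MulAut.conjNormal (Equiv.swap 0 1) : MulAut (alternatingGroup (Fin 5))) *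
      MulAut.conjNormal (Equiv.swap 0 1) = 1 := by
    rw [← map_mul, Equiv.swap_mul_self, map_one]
  refine MulEquiv.ext fun p => Prod.ext ?_ ?_
  · exact DFunLike.congr_fun h p.1
  · exact DFunLike.congr_fun h p.2

theorem swapAut_commute_diagTranspositionAut :
    Commute (swapAut (alternatingGroup (Fin 5))) diagTranspositionAut := by
  refine MulEquiv.ext fun p => ?_
  rfl

/-- The action of `2 ^ 2` on `A_5 × A_5`: the first factor interchanges the two copies of `A_5`,
the second one conjugates both coordinates by a transposition. -/
def altSqAut :
    Cyc 2 × Cyc 2 →* MulAut (alternatingGroup (Fin 5) × alternatingGroup (Fin 5)) :=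
  MonoidHom.noncommCoprod
    (involAut (swapAut _) (swapAut_mul_self _))
    (involAut diagTranspositionAut diagTranspositionAut_mul_self)
    (fun _ _ => swapAut_commute_diagTranspositionAut.pow_pow _ _)

/-- `(A_5 × A_5) : 2 ^ 2`. -/
abbrev AltFiveSq : Type :=
  (alternatingGroup (Fin 5) × alternatingGroup (Fin 5)) ⋊[altSqAut] (Cyc 2 × Cyc 2)

/-- `PGL(2, 9)`. -/
abbrev PGLTwoNine : Type := Matrix.ProjGenLinGroup (Fin 2) (GaloisField 3 2)

end SixTransposition

/-! Conjugates of `x`, `y`, `z` lie in `D`, so the product of any two of them has order at most 6,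
and hence its fourth, fifth or sixth power is trivial (`powEqOne_of_orderOf_le`). A case distinction
over these exponents for at most five such products, such as `xzyz` = `x · zyz` and `xyzyxz` =
`xyzyx · z`, adds relations to `(xy)² = (xz)⁴ = (yz)ʳ = 1`. In every branch the accumulated
relations either bound the group by one of the listed groups, or imply `(xzyz)⁴ = 1` and, for `r =
6`, also `(xzyzyz)⁴ = 1`. For involutions `x`, `t` one has `(xt)² = x · txt`, so `(xt)⁴ = 1` means
that `x` commutes with its conjugate `txt`. With `t = z`, `zyz`, `zyzyz` this makes all conjugates
of `x` under the dihedral group `⟨y, z⟩` commute, which leads to `2 ^ r : D_{2r}`.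

No presented group is needed to identify a branch with a listed group `M`. If generators of `M`
satisfy the relations of the branch, the subgroup of `G × M` generated by the pairs of generators
satisfies them too and projects onto both factors. If the relations force order at most `|M|`, its
projection to `M` is an isomorphism, and its projection to `G` exhibits `G` as a quotient of `M`
(`isQuotientOf_of_check`). It remains to check in each `M` that chosen elements satisfy the
relations and generate, and to count `M`.

The consequences of relations come from Todd–Coxeter enumeration, run in the kernel along prescribed
lists of steps. The lists need no justification: every step preserves the statement that the cosets
can be interpreted as points of a set on which the group acts, so that the table describes the
action (`valid_enumerate`). A word that fixes the base point in the regular action is trivial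
(`Satisfies.of_implies`), and a complete table of cosets bounds an index (`Satisfies.index_le`). An
order is bounded as index times order of a small subgroup (`Satisfies.card_le`), which keeps the
tables short. -/

namespace SixTransposition

/-! ### Coset enumeration

A coset table for a group generated by three involutions, and the operations of a Todd–Coxeter
enumeration on it. Cosets are numbered from `1`, and `0` stands for an undefined entry. -/

/-- The three generators. -/
inductive Gen
  | x | y | z

/-- An entry of a coset table: the images of a coset under the three generators, or a reference to
an equal coset. -/
inductive CosetNode
  | row (a b c : ℕ)
  | fwd (i : ℕ)

namespace CosetNode

/-- The image under a generator recorded in an entry. -/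
def image (s : Gen) : CosetNode → ℕ
  | row a b c => match s with
    | .x => a
    | .y => b
    | .z => c
  | fwd _ => 0

/-- Record the image under a generator. -/
def setImage (s : Gen) (j : ℕ) : CosetNode → CosetNode
  | row a b c => match s with
    | .x => row j b c
    | .y => row a j c
    | .z => row a b j
  | fwd i => fwd i

/-- Whether the images under all generators are known. -/
def isFull : CosetNode → Bool
  | row a b c => !(Nat.beq a 0 || Nat.beq b 0 || Nat.beq c 0)
  | fwd _ => false

end CosetNode

/-- A coset table, as a binary tree in which the entry `i` is found by the binary digits of `i`. -/
inductive CosetTable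
  | nil
  | node (l : CosetTable) (a : CosetNode) (r : CosetTable)

namespace CosetTable

/-- The empty table with a given depth. -/
def empty : ℕ → CosetTable
  | 0 => nil
  | n + 1 => node (empty n) (.row 0 0 0) (empty n)

/-- The entry of a coset. Like `modify` it is given by recursors, which the kernel evaluates
faster than compiled matches. -/
noncomputable def get (t : CosetTable) : ℕ → CosetNode :=
  CosetTable.rec (motive := fun _ => ℕ → CosetNode) (fun _ => .row 0 0 0)
    (fun _ a _ getl getr i =>
      Bool.rec (Bool.rec (getr (Nat.div i 2)) (getl (Nat.div i 2)) (Nat.beq (Nat.mod i 2) 0)) a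
        (Nat.beq i 1)) t

/-- Apply a function to the entry of a coset. -/
noncomputable def modify (g : CosetNode → CosetNode) (t : CosetTable) : ℕ → CosetTable :=
  CosetTable.rec (motive := fun _ => ℕ → CosetTable) (fun _ => nil)
    (fun l a r modl modr i =>
      Bool.rec (Bool.rec (node l a (modr (Nat.div i 2))) (node (modl (Nat.div i 2)) a r)
        (Nat.beq (Nat.mod i 2) 0)) (node l (g a) r) (Nat.beq i 1)) t

/-- Follow the references from a coset. -/
noncomputable def find (t : CosetTable) : ℕ → ℕ → ℕ
  | 0, i => i
  | k + 1, i => match t.get i with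
    | .row _ _ _ => i
    | .fwd j => t.find k j

/-- The bound on the length of chains of references. -/
abbrev findFuel : ℕ := 100

/-- The image of a coset under a generator, if it is known. -/
noncomputable def step (t : CosetTable) (s : Gen) (i : ℕ) : ℕ :=
  match (t.get i).image s with
  | 0 => 0
  | j + 1 => t.find findFuel (j + 1)

/-- Trace a word from a coset as far as possible; return the last coset and the rest of the
word. -/
noncomputable def trace (t : CosetTable) : List Gen → ℕ → ℕ × List Gen
  | [], i => (i, [])
  | s :: w, i => match t.step s i with
    | 0 => (i, s :: w)
    | j + 1 => t.trace w (j + 1)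

/-- Record that a generator interchanges two cosets. -/
noncomputable def link (t : CosetTable) (s : Gen) (i j : ℕ) : CosetTable :=
  (t.modify (CosetNode.setImage s j) i).modify (CosetNode.setImage s i) j

/-- The first nonzero number of two. -/
def pick (a b : ℕ) : ℕ := bif Nat.beq a 0 then b else a

/-- Add a pair to a list if both of its entries are nonzero. -/
def push (a b : ℕ) (q : List (ℕ × ℕ)) : List (ℕ × ℕ) :=
  bif Nat.beq a 0 || Nat.beq b 0 then q else (a, b) :: q

/-- Identify the pairs of cosets in a list, and all the pairs that are equal in consequence. -/
noncomputable def merge : ℕ → CosetTable → List (ℕ × ℕ) → CosetTable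
  | 0, t, _ => t
  | _ + 1, t, [] => t
  | k + 1, t, (a, b) :: q =>
    match t.find findFuel a, t.find findFuel b with
    | 0, _ => t
    | _, 0 => t
    | i + 1, j + 1 =>
      bif Nat.beq i j then merge k t q
      else
        match (bif Nat.ble i j then (i + 1, j + 1) else (j + 1, i + 1) : ℕ × ℕ) with
        | (u, v) =>
          match t.get u, t.get v with
          | .row a₁ b₁ c₁, .row a₂ b₂ c₂ =>
            merge k ((t.modify (fun _ => .fwd u) v).modify
              (fun _ => .row (pick a₁ a₂) (pick b₁ b₂) (pick c₁ c₂)) u)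
              (push a₁ a₂ (push b₁ b₂ (push c₁ c₂ q)))
          | _, _ => t

/-- The bound on the number of identifications in one step. -/
abbrev mergeFuel : ℕ := 10000

/-- Insert a path labelled by a word between two cosets, defining new cosets, which are numbered
from `n` on. -/
noncomputable def connect : CosetTable → ℕ → List Gen → ℕ → ℕ → CosetTable × ℕ
  | t, n, [], i, j => (t.merge mergeFuel [(i, j)], n)
  | t, n, [s], i, j => match t.step s j with
    | 0 => (t.link s i j, n)
    | k + 1 => (t.merge mergeFuel [(i, k + 1)], n)
  | t, n, s :: w, i, j => connect (t.link s i n) (n + 1) w n j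

/-- Make a word fix a coset. -/
noncomputable def scan (p : CosetTable × ℕ) (w : List Gen) (c : ℕ) : CosetTable × ℕ :=
  match p with
  | (t, n) =>
    bif Nat.ble n c then (t, n) else
      match t.find findFuel c with
      | 0 => (t, n)
      | c + 1 =>
        match t.trace w (c + 1) with
        | (i, u) => match t.trace u.reverse (c + 1) with
          | (j, u) => t.connect n u.reverse i j

/-- Enumerate cosets: first make the words in `H` fix the coset `1`, and then make words in `R` fix
cosets as prescribed by a list of pairs (coset, position in `R`). -/
noncomputable def enumerate (R H : List (List Gen)) (l : List (ℕ × ℕ)) : CosetTable × ℕ :=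
  l.foldl (fun p c => scan p (R.getD c.2 []) c.1)
    (H.foldl (fun p w => scan p w 1) (empty 11, 2))

/-- Whether a word is seen to fix the coset `1`. -/
noncomputable def fixesBase (t : CosetTable) (w : List Gen) : Bool :=
  match t.trace w 1 with
  | (i, u) => u.isEmpty && Nat.beq i 1

/-- Whether the images of the cosets below `n` under all generators are known, and the number of
cosets that are not references to others is at most `m`. -/
noncomputable def isComplete (t : CosetTable) (n m : ℕ) : Bool :=
  (List.range n).all (fun i => Nat.beq i 0 || (t.get (t.find findFuel i)).isFull) &&
    Nat.ble ((List.range n).countP fun i => (t.get i).isFull) m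

/-! ### Soundness -/

section Soundness

variable {Ω : Type*} (f : Gen → Ω → Ω)

/-- The action of a word, the first letter being applied first. -/
def act (w : List Gen) (p : Ω) : Ω := w.foldl (fun q s => f s q) p

/-- The interpretation `v` of the cosets below `n` as points agrees with the entry of the coset
`i`. -/
structure NodeValid (v : ℕ → Ω) (n i : ℕ) (a : CosetNode) : Prop where
  image : ∀ s, a.image s ≠ 0 → i < n ∧ a.image s < n ∧ f s (v i) = v (a.image s)
  fwd : ∀ j, a = .fwd j → i < n ∧ j < n ∧ v j = v i

/-- The interpretation `v` of the cosets below `n` as points agrees with the table. -/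
def Valid (v : ℕ → Ω) (n : ℕ) (t : CosetTable) : Prop := ∀ i, NodeValid f v n i (t.get i)

variable {f} {v v' : ℕ → Ω} {n n' : ℕ} {t : CosetTable}

theorem act_reverse_act (hf : ∀ s p, f s (f s p) = p) (w : List Gen) (p : Ω) :
    act f w.reverse (act f w p) = p := by
  induction w generalizing p with
  | nil => rfl
  | cons s w ih =>
    have : act f (s :: w).reverse (act f (s :: w) p) =
        f s (act f w.reverse (act f w (f s p))) := by
      simp [act, List.foldl_append]
    rw [this, ih, hf]

theorem beq_eq_decide (a b : ℕ) : Nat.beq a b = decide (a = b) := by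
  rcases h : Nat.beq a b with _ | _
  · exact (decide_eq_false (Nat.ne_of_beq_eq_false h)).symm
  · exact (decide_eq_true (Nat.eq_of_beq_eq_true h)).symm

theorem get_node (l r : CosetTable) (a : CosetNode) (i : ℕ) :
    (node l a r).get i = if i = 1 then a else if i % 2 = 0 then l.get (i / 2)
      else r.get (i / 2) := by
  change Bool.rec (motive := fun _ => CosetNode) (Bool.rec (motive := fun _ => CosetNode)
    (r.get (i / 2)) (l.get (i / 2)) (Nat.beq (i % 2) 0)) a (Nat.beq i 1) = _
  rw [beq_eq_decide, beq_eq_decide]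
  by_cases h : i = 1 <;> by_cases h' : i % 2 = 0 <;> simp [h, h']

theorem modify_node (g : CosetNode → CosetNode) (l r : CosetTable) (a : CosetNode) (i : ℕ) :
    (node l a r).modify g i = if i = 1 then node l (g a) r
      else if i % 2 = 0 then node (l.modify g (i / 2)) a r
      else node l a (r.modify g (i / 2)) := by
  change Bool.rec (motive := fun _ => CosetTable) (Bool.rec (motive := fun _ => CosetTable)
    (node l a (r.modify g (i / 2))) (node (l.modify g (i / 2)) a r) (Nat.beq (i % 2) 0))
    (node l (g a) r) (Nat.beq i 1) = _
  rw [beq_eq_decide, beq_eq_decide]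
  by_cases h : i = 1 <;> by_cases h' : i % 2 = 0 <;> simp [h, h']

/-- The alternative is needed because a modification beyond the depth of the tree has no effect.
Soundness only needs that nothing else can happen to an entry. -/
theorem get_modify (g : CosetNode → CosetNode) (t : CosetTable) (i j : ℕ) :
    (t.modify g i).get j = t.get j ∨ j = i ∧ (t.modify g i).get j = g (t.get j) := by
  induction t generalizing i j with
  | nil => exact Or.inl rfl
  | node l a r ihl ihr =>
    rw [modify_node]
    split_ifs with h1 h2
    · rw [get_node, get_node]
      split_ifs <;> simp_all
    · rw [get_node, get_node]
      split_ifs with h3 h4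
      · exact Or.inl rfl
      · rcases ihl (i / 2) (j / 2) with h | ⟨h, h'⟩
        · exact Or.inl h
        · exact Or.inr ⟨by omega, h'⟩
      · exact Or.inl rfl
    · rw [get_node, get_node]
      split_ifs with h3 h4
      · exact Or.inl rfl
      · exact Or.inl rfl
      · rcases ihr (i / 2) (j / 2) with h | ⟨h, h'⟩
        · exact Or.inl h
        · exact Or.inr ⟨by omega, h'⟩

theorem get_empty (k i : ℕ) : (empty k).get i = .row 0 0 0 := by
  induction k generalizing i with
  | zero => rfl
  | succ k ih =>
    rw [empty, get_node]
    split_ifs <;> simp [ih]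

theorem nodeValid_row {i a b c : ℕ}
    (ha : a ≠ 0 → i < n ∧ a < n ∧ f .x (v i) = v a)
    (hb : b ≠ 0 → i < n ∧ b < n ∧ f .y (v i) = v b)
    (hc : c ≠ 0 → i < n ∧ c < n ∧ f .z (v i) = v c) : NodeValid f v n i (.row a b c) where
  image s := by cases s <;> assumption
  fwd j h := by cases h

theorem valid_empty (v : ℕ → Ω) (n k : ℕ) : Valid f v n (empty k) := fun i => by
  rw [get_empty]
  exact nodeValid_row (by simp) (by simp) (by simp)

theorem Valid.modify (h : Valid f v n t) (g : CosetNode → CosetNode) (i : ℕ)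
    (hg : NodeValid f v n i (g (t.get i))) : Valid f v n (t.modify g i) := fun j => by
  rcases get_modify g t i j with h' | ⟨rfl, h'⟩
  · rw [h']
    exact h j
  · rw [h']
    exact hg

/-- The bounds in `NodeValid` ensure that no entry in use involves a number from `n` on, so the
interpretation of a fresh coset can be chosen freely. -/
theorem Valid.mono (h : Valid f v n t) (hn : n ≤ n') (hv : ∀ k < n, v' k = v k) :
    Valid f v' n' t := fun i => by
  refine ⟨fun s hs => ?_, fun j hj => ?_⟩
  · obtain ⟨h1, h2, h3⟩ := (h i).image s hs
    exact ⟨h1.trans_le hn, h2.trans_le hn, by rw [hv _ h1, hv _ h2, h3]⟩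
  · obtain ⟨h1, h2, h3⟩ := (h i).fwd j hj
    exact ⟨h1.trans_le hn, h2.trans_le hn, by rw [hv _ h1, hv _ h2, h3]⟩

/-- Each reference joins two names of the same point, so stopping early for lack of fuel is
harmless. -/
theorem Valid.find (h : Valid f v n t) (k : ℕ) {i : ℕ} (hi : i < n) :
    t.find k i < n ∧ v (t.find k i) = v i := by
  induction k generalizing i with
  | zero => exact ⟨hi, rfl⟩
  | succ k ih =>
    rw [CosetTable.find]
    split
    · exact ⟨hi, rfl⟩
    · next j hj =>
      obtain ⟨h1, h2, h3⟩ := (h i).fwd j hj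
      exact ⟨(ih h2).1, (ih h2).2.trans h3⟩

theorem Valid.step (h : Valid f v n t) (s : Gen) (i : ℕ) (hs : t.step s i ≠ 0) :
    t.step s i < n ∧ v (t.step s i) = f s (v i) := by
  rw [CosetTable.step] at hs ⊢
  split at hs
  · exact absurd rfl hs
  · next j hj =>
    obtain ⟨h1, h2, h3⟩ := (h i).image s (by rw [hj]; simp)
    rw [hj] at h2 h3
    exact ⟨(h.find _ h2).1, (h.find _ h2).2.trans h3.symm⟩

theorem Valid.trace (h : Valid f v n t) (w : List Gen) {i : ℕ} (hi : i < n) :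
    (t.trace w i).1 < n ∧ act f (t.trace w i).2 (v (t.trace w i).1) = act f w (v i) := by
  induction w generalizing i with
  | nil => exact ⟨hi, rfl⟩
  | cons s w ih =>
    rw [CosetTable.trace]
    split
    · exact ⟨hi, rfl⟩
    · next j hj =>
      obtain ⟨h1, h2⟩ := h.step s i (by rw [hj]; simp)
      rw [hj] at h1 h2
      refine ⟨(ih h1).1, (ih h1).2.trans ?_⟩
      rw [h2]
      rfl

theorem Valid.link (hf : ∀ s p, f s (f s p) = p) (h : Valid f v n t) {s : Gen} {i j : ℕ}
    (hi : i < n) (hj : j < n) (hs : f s (v i) = v j) : Valid f v n (t.link s i j) := by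
  have key : ∀ {t : CosetTable} {i j : ℕ}, Valid f v n t → i < n → j < n → f s (v i) = v j →
      Valid f v n (t.modify (CosetNode.setImage s j) i) := by
    intro t i j h hi hj hs
    refine h.modify _ _ ?_
    have hi' := h i
    rcases ht : t.get i with ⟨a, b, c⟩ | k
    · rw [ht] at hi'
      have h1 := hi'.image
      cases s
      · exact nodeValid_row (fun _ => ⟨hi, hj, hs⟩) (h1 .y) (h1 .z)
      · exact nodeValid_row (h1 .x) (fun _ => ⟨hi, hj, hs⟩) (h1 .z)
      · exact nodeValid_row (h1 .x) (h1 .y) (fun _ => ⟨hi, hj, hs⟩)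
    · rw [ht] at hi'
      exact hi'
  exact key (key h hi hj hs) hj hi (by rw [← hs, hf])

theorem mem_push {a b : ℕ} {q : List (ℕ × ℕ)} {p : ℕ × ℕ} (hp : p ∈ push a b q) :
    (p = (a, b) ∧ a ≠ 0 ∧ b ≠ 0) ∨ p ∈ q := by
  have h0 : ∀ c, Nat.beq c 0 = false → c ≠ 0 := by rintro c hc rfl; cases hc
  unfold push at hp
  rcases ha : Nat.beq a 0 with _ | _ <;> rcases hb : Nat.beq b 0 with _ | _ <;>
    simp only [ha, hb, Bool.or_false, Bool.or_true, cond_true, cond_false, List.mem_cons] at hp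
  · exact hp.imp_left fun h => ⟨h, h0 _ ha, h0 _ hb⟩
  all_goals exact Or.inr hp

/-- The invariant is that all queued pairs denote equal points. Equal points have equal images under
each generator, so the union of their two rows is valid and the conflicting images may be queued.
Wherever the procedure gives up, it returns a table that is already valid, so neither termination
nor enough fuel has to be proved. -/
theorem Valid.merge (h : Valid f v n t) (k : ℕ) (q : List (ℕ × ℕ))
    (hq : ∀ p ∈ q, p.1 < n ∧ p.2 < n ∧ v p.1 = v p.2) : Valid f v n (t.merge k q) := by
  induction k generalizing t q with
  | zero => exact h
  | succ k ih =>
    rcases q with _ | ⟨⟨a, b⟩, q⟩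
    · exact h
    obtain ⟨ha, hb, hab⟩ := hq (a, b) (by simp)
    have hq' : ∀ p ∈ q, p.1 < n ∧ p.2 < n ∧ v p.1 = v p.2 :=
      fun p hp => hq p (List.mem_cons_of_mem _ hp)
    obtain ⟨ha1, ha2⟩ := h.find findFuel ha
    obtain ⟨hb1, hb2⟩ := h.find findFuel hb
    rw [CosetTable.merge]
    split
    · exact h
    · exact h
    next i j hi hj =>
    rw [hi] at ha1 ha2
    rw [hj] at hb1 hb2
    rcases Nat.beq i j with _ | _
    swap
    · exact ih h q hq'
    have hpair : ∀ u w : ℕ, (bif Nat.ble i j then (i + 1, j + 1) else (j + 1, i + 1)) = (u, w) →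
        u < n ∧ w < n ∧ v u = v w := by
      intro u w huw
      have hv : v (i + 1) = v (j + 1) := ha2.trans (hab.trans hb2.symm)
      rcases hc : Nat.ble i j with _ | _ <;> rw [hc] at huw <;> cases huw
      · exact ⟨hb1, ha1, hv.symm⟩
      · exact ⟨ha1, hb1, hv⟩
    simp only [cond_false]
    rcases huw : (bif Nat.ble i j then (i + 1, j + 1) else (j + 1, i + 1) : ℕ × ℕ) with ⟨u, w⟩
    obtain ⟨hu, hw, huv⟩ := hpair u w huw
    simp only []
    split
    swap
    · exact h
    next a₁ b₁ c₁ a₂ b₂ c₂ h₁ h₂ =>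
    have hU := (h u).image
    have hW := (h w).image
    rw [h₁] at hU
    rw [h₂] at hW
    have hpick : ∀ {a b : ℕ} {s : Gen}, (a ≠ 0 → u < n ∧ a < n ∧ f s (v u) = v a) →
        (b ≠ 0 → w < n ∧ b < n ∧ f s (v w) = v b) →
        pick a b ≠ 0 → u < n ∧ pick a b < n ∧ f s (v u) = v (pick a b) := by
      intro a b s ha hb hab
      unfold pick at hab ⊢
      rcases hc : Nat.beq a 0 with _ | _
      · simp only [cond_false]
        exact ha (fun h0 => by rw [h0] at hc; cases hc)
      · rw [hc] at hab
        simp only [cond_true] at hab ⊢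
        rw [huv]
        exact ⟨hu, (hb hab).2⟩
    refine ih ?_ _ ?_
    · refine (h.modify _ _ ?_).modify _ _ ?_
      · exact ⟨fun s hs => absurd rfl hs, fun j hj => by cases hj; exact ⟨hw, hu, huv⟩⟩
      · exact nodeValid_row (hpick (hU .x) (hW .x)) (hpick (hU .y) (hW .y))
          (hpick (hU .z) (hW .z))
    · intro p hp
      have key : ∀ {a b : ℕ} (s : Gen), (a ≠ 0 → u < n ∧ a < n ∧ f s (v u) = v a) →
          (b ≠ 0 → w < n ∧ b < n ∧ f s (v w) = v b) → (p = (a, b) ∧ a ≠ 0 ∧ b ≠ 0) →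
          p.1 < n ∧ p.2 < n ∧ v p.1 = v p.2 := by
        rintro a b s ha hb ⟨rfl, h1, h2⟩
        refine ⟨(ha h1).2.1, (hb h2).2.1, ?_⟩
        rw [← (ha h1).2.2, ← (hb h2).2.2, huv]
      rcases mem_push hp with h3 | hp
      · exact key .x (hU .x) (hW .x) h3
      rcases mem_push hp with h3 | hp
      · exact key .y (hU .y) (hW .y) h3
      rcases mem_push hp with h3 | hp
      · exact key .z (hU .z) (hW .z) h3
      exact hq' p hp

/-- A new coset on the path is interpreted as the image of its predecessor. Old cosets keep their
interpretation, in particular the base coset. -/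
theorem Valid.connect (hf : ∀ s p, f s (f s p) = p) (h : Valid f v n t) (w : List Gen) {i j : ℕ}
    (hi : i < n) (hj : j < n) (hw : act f w (v i) = v j) :
    ∃ v', Valid f v' (t.connect n w i j).2 (t.connect n w i j).1 ∧ n ≤ (t.connect n w i j).2 ∧
      ∀ k < n, v' k = v k := by
  induction w generalizing t n i v with
  | nil => exact ⟨v, h.merge _ _ (by simpa using ⟨hi, hj, hw⟩), le_rfl, fun _ _ => rfl⟩
  | cons s w ih =>
    rcases w with _ | ⟨s', w⟩
    · rw [CosetTable.connect]
      split
      · exact ⟨v, h.link hf hi hj hw, le_rfl, fun _ _ => rfl⟩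
      -- The image of `j` under the last letter may have been defined while the path was laid, for
      -- instance if the path is closed and begins and ends with the same letter.
      · next k hk =>
        obtain ⟨h1, h2⟩ := h.step s j (by rw [hk]; simp)
        rw [hk] at h1 h2
        refine ⟨v, h.merge _ _ ?_, le_rfl, fun _ _ => rfl⟩
        have hij : v i = v (k + 1) := by
          rw [h2, ← hw]
          exact (hf s _).symm
        simpa using ⟨hi, h1, hij⟩
    · have hv : ∀ k < n, Function.update v n (f s (v i)) k = v k :=
        fun k hk => Function.update_of_ne hk.ne _ _
      have h' : Valid f (Function.update v n (f s (v i))) (n + 1) (t.link s i n) :=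
        (h.mono n.le_succ hv).link hf (hi.trans n.lt_succ_self) n.lt_succ_self
          (by rw [hv i hi, Function.update_self])
      obtain ⟨v', h1, h2, h3⟩ := ih h' n.lt_succ_self (hj.trans n.lt_succ_self)
        (by rw [Function.update_self, hv j hj]; exact hw)
      refine ⟨v', h1, n.le_succ.trans h2, fun k hk => ?_⟩
      rw [h3 k (hk.trans n.lt_succ_self), hv k hk]

/-- The generators act as involutions, so a relator can be traced backwards by reading it in
reverse. The forward trace and the backward trace leave a gap, and since the whole relator fixes the
point, the word in the gap carries the end of the one to the end of the other. -/
theorem Valid.scan (hf : ∀ s p, f s (f s p) = p) {p : CosetTable × ℕ} (h : Valid f v p.2 p.1)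
    (w : List Gen) (c : ℕ) (hw : act f w (v c) = v c) :
    ∃ v', Valid f v' (scan p w c).2 (scan p w c).1 ∧ p.2 ≤ (scan p w c).2 ∧
      ∀ k < p.2, v' k = v k := by
  obtain ⟨t, n⟩ := p
  rw [CosetTable.scan]
  rcases hc : Nat.ble n c with _ | _
  swap
  · exact ⟨v, h, le_rfl, fun _ _ => rfl⟩
  have hcn : c < n := by
    by_contra hcn
    rw [Nat.ble_eq_true_of_le (not_lt.mp hcn)] at hc
    cases hc
  obtain ⟨hd, hdv⟩ := h.find findFuel hcn
  simp only [cond_false]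
  rcases hfd : t.find findFuel c with _ | d
  · exact ⟨v, h, le_rfl, fun _ _ => rfl⟩
  simp only at hd
  rw [hfd] at hd hdv
  obtain ⟨h1, h2⟩ := h.trace w hd
  obtain ⟨h3, h4⟩ := h.trace (t.trace w (d + 1)).2.reverse hd
  refine h.connect hf _ h1 h3 ?_
  rw [hdv, hw, ← hdv] at h2
  rw [← h2, act_reverse_act hf] at h4
  rw [← h4, act_reverse_act hf]

theorem valid_enumerate (hf : ∀ s p, f s (f s p) = p) (R H : List (List Gen))
    (l : List (ℕ × ℕ)) (p : Ω) (hR : ∀ w ∈ R, ∀ q, act f w q = q)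
    (hH : ∀ w ∈ H, act f w p = p) :
    ∃ v, Valid f v (enumerate R H l).2 (enumerate R H l).1 ∧ 2 ≤ (enumerate R H l).2 ∧
      v 1 = p := by
  have hH' : ∀ (H : List (List Gen)) (st : CosetTable × ℕ), (∀ w ∈ H, act f w p = p) →
      (∃ v, Valid f v st.2 st.1 ∧ 2 ≤ st.2 ∧ v 1 = p) →
      ∃ v, Valid f v (H.foldl (fun p w => scan p w 1) st).2 (H.foldl (fun p w => scan p w 1) st).1 ∧
        2 ≤ (H.foldl (fun p w => scan p w 1) st).2 ∧ v 1 = p := by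
    intro H
    induction H with
    | nil => exact fun st _ h => h
    | cons w H ih =>
      rintro st hH ⟨v, hv, h2, h1⟩
      obtain ⟨v', hv', h2', h1'⟩ := hv.scan hf w 1 (by rw [h1]; exact hH w (by simp))
      exact ih _ (fun w hw => hH w (List.mem_cons_of_mem _ hw))
        ⟨v', hv', h2.trans h2', (h1' 1 h2).trans h1⟩
  have hl : ∀ (l : List (ℕ × ℕ)) (st : CosetTable × ℕ),
      (∃ v, Valid f v st.2 st.1 ∧ 2 ≤ st.2 ∧ v 1 = p) →
      ∃ v, Valid f v (l.foldl (fun p c => scan p (R.getD c.2 []) c.1) st).2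
          (l.foldl (fun p c => scan p (R.getD c.2 []) c.1) st).1 ∧
        2 ≤ (l.foldl (fun p c => scan p (R.getD c.2 []) c.1) st).2 ∧ v 1 = p := by
    intro l
    induction l with
    | nil => exact fun st h => h
    | cons c l ih =>
      rintro st ⟨v, hv, h2, h1⟩
      have hw : act f (R.getD c.2 []) (v c.1) = v c.1 := by
        rcases lt_or_ge c.2 R.length with hc | hc
        · rw [List.getD_eq_getElem _ _ hc]
          exact hR _ (List.getElem_mem hc) _
        · rw [List.getD_eq_default _ _ hc]
          rfl
      obtain ⟨v', hv', h2', h1'⟩ := hv.scan hf _ c.1 hw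
      exact ih _ ⟨v', hv', h2.trans h2', (h1' 1 h2).trans h1⟩
  exact hl l _ (hH' H _ hH ⟨fun _ => p, valid_empty _ _ _, le_rfl, rfl⟩)

theorem Valid.act_eq_of_fixesBase (h : Valid f v n t) (hn : 2 ≤ n) {w : List Gen}
    (hw : t.fixesBase w = true) : act f w (v 1) = v 1 := by
  obtain ⟨-, h2⟩ := h.trace w hn
  rw [fixesBase] at hw
  simp only [Bool.and_eq_true, List.isEmpty_iff] at hw
  rw [← h2, hw.1, Nat.eq_of_beq_eq_true hw.2]
  rfl

/-- The live cosets are those with full rows. An image recorded in such a row may be an outdated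
name, but following references leads to a live coset for the same point, so the set of their points
is closed under the generators. -/
theorem Valid.exists_finset (h : Valid f v n t) (hn : 2 ≤ n) {m : ℕ}
    (hc : t.isComplete n m = true) :
    ∃ S : Finset ℕ, S.card ≤ m ∧ v 1 ∈ v '' S ∧ ∀ s, ∀ p ∈ v '' (S : Set ℕ), f s p ∈ v '' S := by
  classical
  rw [isComplete, Bool.and_eq_true, List.all_eq_true] at hc
  obtain ⟨hc, hm⟩ := hc
  have key : ∀ i < n, i ≠ 0 → v i ∈ v '' ((Finset.range n).filter
      fun i => (t.get i).isFull = true : Finset ℕ) := by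
    intro i hi h0
    have h1 := hc i (List.mem_range.mpr hi)
    have h2 : Nat.beq i 0 = false := by
      rcases hb : Nat.beq i 0 with _ | _
      · rfl
      · exact absurd (Nat.eq_of_beq_eq_true hb) h0
    rw [h2, Bool.false_or] at h1
    obtain ⟨h3, h4⟩ := h.find findFuel hi
    exact ⟨_, by simpa using ⟨h3, h1⟩, h4⟩
  refine ⟨(Finset.range n).filter fun i => (t.get i).isFull = true, ?_, key 1 hn one_ne_zero, ?_⟩
  · refine le_trans (le_of_eq ?_) (Nat.le_of_ble_eq_true hm)
    rw [Finset.card_def, Finset.filter_val, Finset.range_val, Multiset.range,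
      Multiset.filter_coe, Multiset.coe_card, List.countP_eq_length_filter]
    simp
  · rintro s p ⟨i, hi, rfl⟩
    have hi : i < n ∧ (t.get i).isFull = true := by simpa using hi
    have h0 : (t.get i).image s ≠ 0 := by
      have hfull := hi.2
      generalize t.get i = a at hfull
      rcases a with ⟨a, b, c⟩ | j
      · rintro h0
        have : (Nat.beq a 0 || Nat.beq b 0 || Nat.beq c 0) = true := by
          cases s <;> change _ = 0 at h0 <;> simp only [CosetNode.image] at h0 <;> subst h0 <;>
            simp
        rw [CosetNode.isFull, this] at hfull
        cases hfull
      · cases hfull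
    obtain ⟨-, h1, h2⟩ := (h i).image s h0
    rw [h2]
    exact key _ h1 h0

end Soundness

end CosetTable
/-! ### Groups generated by three involutions -/

/-- The value of a word in a group. -/
def wordProd {G : Type*} [Group G] (g : Gen → G) (w : List Gen) : G := (w.map g).prod

/-- A list of relations, consisting of words together with exponents. -/
abbrev Relations : Type := List (List Gen × ℕ)

/-- A power of a word. -/
def wordPow (r : List Gen × ℕ) : List Gen := (List.replicate r.2 r.1).flatten

/-- The relators of a list of relations, and the squares of the generators. -/
def relators (R : Relations) : List (List Gen) :=
  [.x, .x] :: [.y, .y] :: [.z, .z] :: R.map wordPow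

/-- The elements `g` are involutions or trivial, and satisfy the relations. -/
structure Satisfies {G : Type*} [Group G] (g : Gen → G) (R : Relations) : Prop where
  mul_self : ∀ s, g s * g s = 1
  pow_eq_one : ∀ r ∈ R, wordProd g r.1 ^ r.2 = 1

/-- The relations that result from words for three further elements in terms of the generators. -/
def substRelations (h : Gen → List Gen) (S : Relations) : Relations :=
  (h .x, 2) :: (h .y, 2) :: (h .z, 2) :: S.map fun r => (r.1.flatMap h, r.2)

/-- Whether a coset enumeration shows that the relations `R` imply the relations `S`. -/
noncomputable def implies (R S : Relations) (l : List (ℕ × ℕ)) : Bool :=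
  match CosetTable.enumerate (relators R) [] l with
  | (t, _) => S.all fun r => t.fixesBase (wordPow r)

/-- Whether a coset enumeration shows that the subgroup generated by words has index at most
`m`. -/
noncomputable def boundsIndex (R : Relations) (H : List (List Gen)) (m : ℕ)
    (l : List (ℕ × ℕ)) : Bool :=
  match CosetTable.enumerate (relators R) H l with
  | (t, n) => t.isComplete n m

/-- Data for a proof that a group with three generators has at most `index * card` elements: words
that generate a subgroup, relations between these words, and coset enumerations for these
relations, for the index of the subgroup and for its order. -/
structure CardCertificate where
  sub : Gen → List Gen
  subRelations : Relations
  index : ℕ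
  card : ℕ
  relationScans : List (ℕ × ℕ)
  indexScans : List (ℕ × ℕ)
  cardScans : List (ℕ × ℕ)

/-- Whether a certificate is correct. -/
noncomputable def CardCertificate.check (c : CardCertificate) (R : Relations) : Bool :=
  implies R (substRelations c.sub c.subRelations) c.relationScans &&
    (boundsIndex R [c.sub .x, c.sub .y, c.sub .z] c.index c.indexScans &&
      boundsIndex c.subRelations [] c.card c.cardScans)

section

variable {G : Type*} [Group G] {g : Gen → G} {R S : Relations}

theorem wordProd_append (g : Gen → G) (w₁ w₂ : List Gen) :
    wordProd g (w₁ ++ w₂) = wordProd g w₁ * wordProd g w₂ := by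
  simp [wordProd]

theorem wordProd_wordPow (g : Gen → G) (r : List Gen × ℕ) :
    wordProd g (wordPow r) = wordProd g r.1 ^ r.2 := by
  obtain ⟨w, n⟩ := r
  induction n with
  | zero => simp [wordPow, wordProd]
  | succ n ih =>
    have : wordPow (w, n + 1) = w ++ wordPow (w, n) := by simp [wordPow, List.replicate_succ]
    rw [this, wordProd_append, ih, pow_succ']

theorem wordProd_flatMap (g : Gen → G) (h : Gen → List Gen) (w : List Gen) :
    wordProd g (w.flatMap h) = wordProd (fun s => wordProd g (h s)) w := by
  induction w with
  | nil => rfl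
  | cons s w ih => rw [List.flatMap_cons, wordProd_append, ih]; simp [wordProd]

theorem Satisfies.wordProd_relators (h : Satisfies g R) {w : List Gen} (hw : w ∈ relators R) :
    wordProd g w = 1 := by
  simp only [relators, List.mem_cons, List.mem_map] at hw
  rcases hw with rfl | rfl | rfl | ⟨r, hr, rfl⟩
  · simpa [wordProd] using h.mul_self .x
  · simpa [wordProd] using h.mul_self .y
  · simpa [wordProd] using h.mul_self .z
  · rw [wordProd_wordPow, h.pow_eq_one r hr]

/-- The first letter acts first while the action is on the left, so the letters are multiplied in
reverse order; for involutions this gives the inverse. -/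
theorem Satisfies.act_eq (h : Satisfies g R) {Ω : Type*} [MulAction G Ω] (w : List Gen) (p : Ω) :
    CosetTable.act (fun s q => g s • q) w p = (wordProd g w)⁻¹ • p := by
  induction w generalizing p with
  | nil => simp [CosetTable.act, wordProd]
  | cons s w ih =>
    have h1 : CosetTable.act (fun s q => g s • q) (s :: w) p =
        CosetTable.act (fun s q => g s • q) w (g s • p) := rfl
    have h2 : wordProd g (s :: w) = g s * wordProd g w := by simp [wordProd]
    rw [h1, ih, h2, mul_inv_rev, mul_smul, inv_eq_of_mul_eq_one_left (h.mul_self s)]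

theorem Satisfies.smul_smul_self (h : Satisfies g R) {Ω : Type*} [MulAction G Ω] (s : Gen)
    (p : Ω) : g s • g s • p = p := by
  rw [smul_smul, h.mul_self, one_smul]

/-- In the action of `G` on itself by multiplication only the identity fixes the point `1`. The
table may be incomplete here. -/
theorem Satisfies.of_implies (h : Satisfies g R) (l : List (ℕ × ℕ))
    (hl : implies R S l = true) : Satisfies g S := by
  refine ⟨h.mul_self, fun r hr => ?_⟩
  obtain ⟨v, hv, h2, h1⟩ := CosetTable.valid_enumerate (f := fun s q => g s • q)
    (h.smul_smul_self) (relators R) [] l (1 : G)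
    (fun w hw q => by rw [h.act_eq, h.wordProd_relators hw, inv_one, one_smul]) (by simp)
  rw [implies] at hl
  have := hv.act_eq_of_fixesBase h2 (List.all_eq_true.mp hl r hr)
  rw [h1, h.act_eq, wordProd_wordPow] at this
  simpa using this

/-- In the action on `G ⧸ K` the words in `H` fix the base coset. The points of a complete table
form a nonempty set stable under `G`, which is everything by transitivity. -/
theorem Satisfies.index_le (h : Satisfies g R) (hg : Subgroup.closure (Set.range g) = ⊤)
    (K : Subgroup G) {H : List (List Gen)} (hH : ∀ w ∈ H, wordProd g w ∈ K) {m : ℕ}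
    (l : List (ℕ × ℕ)) (hl : boundsIndex R H m l = true) : K.index ≠ 0 ∧ K.index ≤ m := by
  obtain ⟨v, hv, h2, h1⟩ := CosetTable.valid_enumerate (f := fun s (q : G ⧸ K) => g s • q)
    (h.smul_smul_self) (relators R) H l ((1 : G) : G ⧸ K)
    (fun w hw q => by rw [h.act_eq, h.wordProd_relators hw, inv_one, one_smul])
    (fun w hw => by
      rw [h.act_eq, MulAction.Quotient.smul_coe, smul_eq_mul, mul_one, QuotientGroup.eq]
      simpa using hH w hw)
  rw [boundsIndex] at hl
  obtain ⟨S, hS, hS1, hSg⟩ := hv.exists_finset h2 hl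
  have huniv : v '' (S : Set ℕ) = Set.univ := by
    have hstab : ∀ a : G, ∀ p ∈ v '' (S : Set ℕ), a • p ∈ v '' (S : Set ℕ) := by
      intro a
      have ha : a ∈ Subgroup.closure (Set.range g) := hg ▸ Subgroup.mem_top a
      induction ha using Subgroup.closure_induction'' with
      | mem a ha =>
        obtain ⟨s, rfl⟩ := ha
        exact hSg s
      | inv_mem a ha =>
        obtain ⟨s, rfl⟩ := ha
        rw [inv_eq_of_mul_eq_one_left (h.mul_self s)]
        exact hSg s
      | one => simp
      | mul a b _ _ ha hb =>
        intro p hp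
        rw [mul_smul]
        exact ha _ (hb _ hp)
    refine Set.eq_univ_of_forall fun p => ?_
    induction p using QuotientGroup.induction_on with
    | H a =>
      have := hstab a _ hS1
      rwa [h1, MulAction.Quotient.smul_coe, smul_eq_mul, mul_one] at this
  have hfin : (v '' (S : Set ℕ)).Finite := S.finite_toSet.image v
  have : Finite (G ⧸ K) := Set.finite_univ_iff.mp (huniv ▸ hfin)
  refine ⟨Subgroup.index_ne_zero_of_finite, ?_⟩
  rw [Subgroup.index, ← Set.ncard_univ, ← huniv]
  refine (Set.ncard_image_le S.finite_toSet).trans ?_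
  rwa [Set.ncard_coe_finset]

/-- The index bound is used twice: for the subgroup generated by the words of the certificate, and
for the trivial subgroup inside it, where the relations between these words take the place of `R`.
-/
theorem Satisfies.card_le (h : Satisfies g R) (hg : Subgroup.closure (Set.range g) = ⊤)
    (c : CardCertificate) (hc : c.check R = true) :
    Nat.card G ≠ 0 ∧ Nat.card G ≤ c.index * c.card := by
  simp only [CardCertificate.check, Bool.and_eq_true] at hc
  obtain ⟨h1, h2, h3⟩ := hc
  have hS := h.of_implies _ h1
  let k : Gen → G := fun s => wordProd g (c.sub s)
  let K : Subgroup G := Subgroup.closure (Set.range k)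
  let k' : Gen → K := fun s => ⟨k s, Subgroup.subset_closure ⟨s, rfl⟩⟩
  have hcoe : ∀ w, ((wordProd k' w : K) : G) = wordProd k w := by
    intro w
    simp [wordProd, k', List.map_map, Function.comp_def]
  have hk' : Satisfies k' c.subRelations := by
    constructor
    · intro s
      ext
      have := hS.pow_eq_one (c.sub s, 2) (by cases s <;> simp [substRelations])
      rw [pow_two] at this
      exact this
    · intro r hr
      ext
      have := hS.pow_eq_one (r.1.flatMap c.sub, r.2)
        (by simp only [substRelations, List.mem_cons, List.mem_map]
            exact Or.inr (Or.inr (Or.inr ⟨r, hr, rfl⟩)))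
      rw [wordProd_flatMap] at this
      rw [Subgroup.coe_pow, hcoe]
      exact this
  have hgen : Subgroup.closure (Set.range k') = ⊤ := by
    have : Set.range k' = ((↑) : K → G) ⁻¹' Set.range k := by
      ext a
      simp [k', Subtype.ext_iff]
    rw [this]
    exact Subgroup.closure_closure_coe_preimage
  obtain ⟨i1, i2⟩ := h.index_le hg K (H := [c.sub .x, c.sub .y, c.sub .z]) (by
    intro w hw
    simp only [List.mem_cons, List.not_mem_nil, or_false] at hw
    rcases hw with rfl | rfl | rfl
    · exact Subgroup.subset_closure ⟨.x, rfl⟩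
    · exact Subgroup.subset_closure ⟨.y, rfl⟩
    · exact Subgroup.subset_closure ⟨.z, rfl⟩) _ h2
  obtain ⟨j1, j2⟩ := hk'.index_le hgen ⊥ (H := []) (by simp) _ h3
  rw [Subgroup.index_bot] at j1 j2
  rw [← K.index_mul_card]
  exact ⟨mul_ne_zero i1 j1, Nat.mul_le_mul i2 j2⟩

/-- The subgroup `K` of `G × M` generated by the pairs `(g s, a s)` satisfies `R`, so its order is
at most `|M|`. It maps onto `M`, hence isomorphically, and it also maps onto `G`. -/
theorem isQuotientOf_of_check {M : Type*} [Group M] {a : Gen → M} (hg : Satisfies g R)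
    (hgen : Subgroup.closure (Set.range g) = ⊤) (ha : Satisfies a R)
    (hagen : Subgroup.closure (Set.range a) = ⊤) (c : CardCertificate) (hc : c.check R = true)
    (hM : c.index * c.card ≤ Nat.card M) : IsQuotientOf G M := by
  let K : Subgroup (G × M) := Subgroup.closure (Set.range fun s => (g s, a s))
  let k : Gen → K := fun s => ⟨(g s, a s), Subgroup.subset_closure ⟨s, rfl⟩⟩
  have hword : ∀ w, ((wordProd k w : K) : G × M) = (wordProd g w, wordProd a w) := by
    intro w
    induction w with
    | nil => rfl
    | cons s w ih =>
      have h1 : wordProd k (s :: w) = k s * wordProd k w := by simp [wordProd]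
      rw [h1, Subgroup.coe_mul, ih]
      simp [wordProd, k]
  have hk : Satisfies k R := by
    constructor
    · intro s
      ext <;> simp [k, hg.mul_self, ha.mul_self]
    · intro r hr
      apply Subtype.ext
      rw [Subgroup.coe_pow, hword, Prod.pow_mk, hg.pow_eq_one r hr, ha.pow_eq_one r hr]
      rfl
  have hkgen : Subgroup.closure (Set.range k) = ⊤ := by
    have : Set.range k = ((↑) : K → G × M) ⁻¹' Set.range fun s => (g s, a s) := by
      ext p
      simp [k, Subtype.ext_iff]
    rw [this]
    exact Subgroup.closure_closure_coe_preimage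
  obtain ⟨h1, h2⟩ := hk.card_le hkgen c hc
  have : Finite K := Nat.finite_of_card_ne_zero h1
  let p : K →* G := (MonoidHom.fst G M).comp K.subtype
  let q : K →* M := (MonoidHom.snd G M).comp K.subtype
  have hp : Function.Surjective p := by
    rw [← MonoidHom.range_eq_top, eq_top_iff, ← hgen, Subgroup.closure_le]
    rintro _ ⟨s, rfl⟩
    exact ⟨k s, rfl⟩
  have hq : Function.Surjective q := by
    rw [← MonoidHom.range_eq_top, eq_top_iff, ← hagen, Subgroup.closure_le]
    rintro _ ⟨s, rfl⟩
    exact ⟨k s, rfl⟩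
  have hq' : Function.Bijective q := by
    rw [Nat.bijective_iff_surjective_and_card]
    exact ⟨hq, le_antisymm (h2.trans hM) (Nat.card_le_card_of_surjective q hq)⟩
  exact ⟨p.comp (MulEquiv.ofBijective q hq').symm.toMonoidHom,
    hp.comp (MulEquiv.ofBijective q hq').symm.surjective⟩

end
/-! ### The relations -/

/-- The word `xzyz`, the product of `x` and a conjugate of `y`. -/
def xzyz : List Gen := [.x, .z, .y, .z]

/-- The word `xzyzyz`, the product of `x` and a conjugate of `z`. -/
def xzyzyz : List Gen := [.x, .z, .y, .z, .y, .z]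

/-- The word `xyzyxz`, the product of a conjugate of `z` and `z`. -/
def xyzyxz : List Gen := [.x, .y, .z, .y, .x, .z]

/-- The word `xyzyzyxz`, the product of a conjugate of `y` and `z`. -/
def xyzyzyxz : List Gen := [.x, .y, .z, .y, .z, .y, .x, .z]

/-- The word `xyzyzyxzyz`, the product of two conjugates of `y`. -/
def xyzyzyxzyz : List Gen := [.x, .y, .z, .y, .z, .y, .x, .z, .y, .z]

/-- The relations `(xy)² = (xz)⁴ = (yz)ʳ = 1` together with further ones. -/
def relations (r : ℕ) (R : Relations) : Relations :=
  ([.x, .y], 2) :: ([.x, .z], 4) :: ([.y, .z], r) :: R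

/-- Three elements as a family. -/
def triple {G : Type*} (x y z : G) : Gen → G
  | .x => x
  | .y => y
  | .z => z

theorem range_triple {G : Type*} (x y z : G) : Set.range (triple x y z) = {x, y, z} := by
  ext a
  constructor
  · rintro ⟨s, rfl⟩
    cases s <;> simp [triple]
  · rintro (rfl | rfl | rfl)
    exacts [⟨.x, rfl⟩, ⟨.y, rfl⟩, ⟨.z, rfl⟩]

theorem satisfies_triple {G : Type*} [Group G] {x y z : G} {R : Relations} (hx : x * x = 1)
    (hy : y * y = 1) (hz : z * z = 1)
    (hR : R.Forall fun r => wordProd (triple x y z) r.1 ^ r.2 = 1) :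
    Satisfies (triple x y z) R :=
  ⟨by rintro (_ | _ | _) <;> assumption, List.forall_iff_forall_mem.mp hR⟩

/-! ### Generation of semidirect products -/

section Generation

variable {N H : Type*} [Group N] [Group H] {φ : H →* MulAut N}

theorem eq_top_of_inl_mem (K : Subgroup (N ⋊[φ] H))
    (hH : K.map SemidirectProduct.rightHom = ⊤)
    (hN : ∀ n : N, SemidirectProduct.inl n ∈ K) : K = ⊤ := by
  rw [eq_top_iff]
  intro a _
  obtain ⟨b, hb, hab⟩ : a.right ∈ K.map SemidirectProduct.rightHom := hH ▸ Subgroup.mem_top _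
  have : a = SemidirectProduct.inl (a.left * b.left⁻¹) * b := by
    ext
    · simp
    · simpa using hab.symm
  rw [this]
  exact K.mul_mem (hN _) hb

theorem eq_top_of_mulSingle_mem {ι : Type*} [Finite ι] [DecidableEq ι] {p : ℕ} [NeZero p]
    (K : Subgroup (ι → Cyc p)) (h : ∀ i, Pi.mulSingle i (.ofAdd 1) ∈ K) : K = ⊤ := by
  rw [eq_top_iff]
  intro f _
  refine Subgroup.pi_mem_of_mulSingle_mem f fun i => ?_
  have hi : f i = (Multiplicative.ofAdd (1 : ZMod p)) ^ (Multiplicative.toAdd (f i)).val := by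
    rw [← ofAdd_nsmul, nsmul_one, ZMod.natCast_zmod_val, ofAdd_toAdd]
  rw [hi, Pi.mulSingle_pow]
  exact K.pow_mem (h i) _

/-- As `N` is commutative, conjugation by an element of `K` acts on `N` through its image in `H`,
and these images exhaust `H`. Thus `K` contains the whole `H`-orbit of `n`, which in the coordinates
`c` includes a basis. -/
theorem eq_top_of_orbit {ι : Type*} [Finite ι] {p : ℕ} [NeZero p] (hcomm : ∀ a b : N, a * b = b * a)
    (K : Subgroup (N ⋊[φ] H)) (hH : K.map SemidirectProduct.rightHom = ⊤) (n : N)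
    (hn : SemidirectProduct.inl n ∈ K) (c : N →* (ι → Cyc p)) (hc : Function.Injective c)
    [DecidableEq ι] (horbit : ∀ i, ∃ h, c (φ h n) = Pi.mulSingle i (.ofAdd 1)) : K = ⊤ := by
  have hP : ∀ h, SemidirectProduct.inl (φ h n) ∈ K := by
    intro h
    obtain ⟨b, hb, rfl⟩ : h ∈ K.map SemidirectProduct.rightHom := hH ▸ Subgroup.mem_top _
    have : SemidirectProduct.inl (φ (SemidirectProduct.rightHom b) n) =
        b * SemidirectProduct.inl n * b⁻¹ := by
      ext
      · simp [hcomm b.left]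
      · simp
    rw [this]
    exact K.mul_mem (K.mul_mem hb hn) (K.inv_mem hb)
  have htop : (K.comap SemidirectProduct.inl).map c = ⊤ :=
    eq_top_of_mulSingle_mem _ fun i =>
      let ⟨h, hh⟩ := horbit i
      ⟨φ h n, hP h, hh⟩
  refine eq_top_of_inl_mem K hH fun m => ?_
  obtain ⟨m', hm', h⟩ : c m ∈ (K.comap SemidirectProduct.inl).map c := htop ▸ Subgroup.mem_top _
  rw [← hc h]
  exact hm'

theorem card_eq_of_orbit {ι : Type*} [Finite ι] {p : ℕ} [NeZero p] (n : N)
    (c : N →* (ι → Cyc p)) (hc : Function.Injective c)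
    [DecidableEq ι] (horbit : ∀ i, ∃ h, c (φ h n) = Pi.mulSingle i (.ofAdd 1)) :
    Nat.card N = p ^ Nat.card ι := by
  have htop : c.range = ⊤ := eq_top_of_mulSingle_mem _ fun i =>
    let ⟨h, hh⟩ := horbit i
    ⟨φ h n, hh⟩
  rw [Nat.card_eq_of_bijective c ⟨hc, MonoidHom.range_eq_top.mp htop⟩, Nat.card_fun]
  congr 1
  exact Nat.card_zmod p

theorem eq_top_of_prod (C : Type*) [Group C] {L : Type*} [Group L] (K : Subgroup (C × L))
    (hL : K.map (MonoidHom.snd C L) = ⊤) (hC : ∀ c : C, (c, 1) ∈ K) : K = ⊤ := by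
  rw [eq_top_iff]
  rintro ⟨c, l⟩ _
  obtain ⟨⟨c', l'⟩, hb, rfl⟩ : l ∈ K.map (MonoidHom.snd C L) := hL ▸ Subgroup.mem_top _
  have : (c, l') = (c * c'⁻¹, 1) * (c', l') := by simp
  rw [show (MonoidHom.snd C L) (c', l') = l' from rfl, this]
  exact K.mul_mem (hC _) hb

theorem map_closure_range {G L : Type*} [Group G] [Group L] (f : G →* L) (a : Gen → G) :
    (Subgroup.closure (Set.range a)).map f = Subgroup.closure (Set.range (f ∘ a)) := by
  rw [MonoidHom.map_closure, Set.range_comp]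

theorem mem_closure_range {G : Type*} [Group G] (a : Gen → G) (s : Gen) :
    a s ∈ Subgroup.closure (Set.range a) := Subgroup.subset_closure ⟨s, rfl⟩

theorem wordProd_mem_closure {G : Type*} [Group G] (a : Gen → G) (w : List Gen) :
    wordProd a w ∈ Subgroup.closure (Set.range a) := by
  refine Subgroup.list_prod_mem _ fun b hb => ?_
  obtain ⟨s, -, rfl⟩ := List.mem_map.mp hb
  exact mem_closure_range a s

theorem mem_closure_of_wordProd {G : Type*} [Group G] {a : Gen → G} {b : G} (w : List Gen)
    (h : wordProd a w = b) : b ∈ Subgroup.closure (Set.range a) := h ▸ wordProd_mem_closure a w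

end Generation

end SixTransposition

namespace SixTransposition

open Equiv

/-! ### Generators of the groups -/

section

/-- Equality in a semidirect product is decided componentwise, in a form that the kernel can
evaluate. -/
@[reducible]
def decEqSemidirectProduct {N H : Type*} [Group N] [Group H] [DecidableEq N] [DecidableEq H]
    (φ : H →* MulAut N) : DecidableEq (N ⋊[φ] H) := fun a b =>
  decidable_of_iff (a.left = b.left ∧ a.right = b.right) SemidirectProduct.ext_iff.symm

/-- Equality in a product is decided componentwise, in a form that the kernel can evaluate. -/
@[reducible]
def decEqProd {N H : Type*} [DecidableEq N] [DecidableEq H] : DecidableEq (N × H) := fun a b =>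
  decidable_of_iff (a.1 = b.1 ∧ a.2 = b.2) Prod.ext_iff.symm

attribute [local instance] decEqSemidirectProduct decEqProd

/-! #### The groups `2 ^ n : D_{2n}` -/

theorem closure_dihedral (n : ℕ) (K : Subgroup (DihedralGroup n)) (h0 : .sr 0 ∈ K)
    (h1 : .sr 1 ∈ K) : K = ⊤ := by
  have h : DihedralGroup.r 1 ∈ K := by
    have := K.mul_mem h0 h1
    rwa [DihedralGroup.sr_mul_sr, sub_zero] at this
  have hr : ∀ i : ZMod n, DihedralGroup.r i ∈ K := by
    intro i
    obtain ⟨k, rfl⟩ := ZMod.intCast_surjective i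
    rw [← DihedralGroup.r_one_zpow]
    exact K.zpow_mem h k
  rw [eq_top_iff]
  rintro (i | i) _
  · exact hr i
  · have := K.mul_mem h0 (hr i)
    rwa [DihedralGroup.sr_mul_r, zero_add] at this

/-- Generators of `2 ^ n : D_{2n}`. -/
def dihedralGens (n : ℕ) : Gen → TwoPowDihedral n :=
  triple (.inl (Pi.mulSingle 0 (.ofAdd 1))) (.inr (.sr 0)) (.inr (.sr 1))

theorem closure_dihedralGens (n : ℕ) [NeZero n] :
    Subgroup.closure (Set.range (dihedralGens n)) = ⊤ := by
  refine eq_top_of_orbit mul_comm _ ?_ (Pi.mulSingle 0 (.ofAdd 1)) (mem_closure_range _ .x)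
    (MonoidHom.id _) Function.injective_id fun i => ⟨.r i, ?_⟩
  · rw [map_closure_range]
    exact closure_dihedral n _ (mem_closure_range _ .y) (mem_closure_range _ .z)
  · funext k
    change (Pi.mulSingle 0 (Multiplicative.ofAdd 1) : ZMod n → Cyc 2) (-i + k) = _
    rw [Pi.mulSingle_apply, Pi.mulSingle_apply]
    simp only [neg_add_eq_zero, eq_comm]

theorem card_twoPowDihedral (n : ℕ) [NeZero n] :
    Nat.card (TwoPowDihedral n) = 2 ^ n * (2 * n) := by
  rw [SemidirectProduct.card, Nat.card_fun, Nat.card_zmod, DihedralGroup.nat_card]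
  congr 2
  exact Nat.card_zmod 2

theorem satisfies_dihedralGens_five :
    Satisfies (dihedralGens 5) (relations 5 [(xzyz, 4)]) := by
  refine satisfies_triple ?_ ?_ ?_ ?_ <;> decide +kernel

theorem satisfies_dihedralGens_six :
    Satisfies (dihedralGens 6) (relations 6 [(xzyz, 4), (xzyzyz, 4)]) := by
  refine satisfies_triple ?_ ?_ ?_ ?_ <;> decide +kernel

/-! #### The symmetric group of degree five -/

/-- A transposition and a `p`-cycle generate the symmetric group of prime degree `p`; the last two
hypotheses say in decidable form that `σ` is a 5-cycle. -/
theorem closure_perm_five (K : Subgroup (Perm (Fin 5))) (h1 : swap 0 1 ∈ K)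
    {σ : Perm (Fin 5)} (hσ : σ ∈ K) (hs : ∀ i, σ i ≠ i)
    (hc : ∀ i, ∃ k : Fin 5, (σ ^ (k : ℕ)) 0 = i) : K = ⊤ := by
  rw [eq_top_iff, ← Perm.closure_prime_cycle_swap (σ := σ) (τ := swap 0 1) (by decide)
    ⟨0, hs 0, fun i _ => let ⟨k, hk⟩ := hc i; ⟨k, by simpa using hk⟩⟩
    (Finset.eq_univ_of_forall fun i => Perm.mem_support.mpr (hs i)) ⟨0, 1, by decide, rfl⟩,
    Subgroup.closure_le]
  rintro _ (rfl | rfl)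
  exacts [hσ, h1]

/-! #### The group `2 × (2 ^ 4 : S_5)` -/

/-- The even subset consisting of the first two points. -/
def firstPair : evenSubsets :=
  ⟨Pi.mulSingle 0 (.ofAdd 1) * Pi.mulSingle 1 (.ofAdd 1), by
    change ∏ i, _ = _
    decide +kernel⟩

/-- Generators of `2 × (2 ^ 4 : S_5)`. -/
def subsetGens : Gen → Cyc 2 × TwoPowFourSymm :=
  triple (1, .inr (swap 0 1)) (.ofAdd 1, ⟨firstPair, swap 0 1 * swap 2 3⟩)
    (.ofAdd 1, .inr (swap 0 4 * swap 1 2))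

theorem satisfies_subsetGens :
    Satisfies subsetGens (relations 5 [(xzyz, 6), (xyzyxz, 6)]) := by
  refine satisfies_triple ?_ ?_ ?_ ?_ <;> decide +kernel

/-- The coordinates of an even subset at the first four points. -/
def subsetCoords : evenSubsets →* (Fin 4 → Cyc 2) where
  toFun f i := (f : Fin 5 → Cyc 2) i.castSucc
  map_one' := rfl
  map_mul' _ _ := rfl

theorem subsetCoords_injective : Function.Injective subsetCoords := by
  rw [injective_iff_map_eq_one]
  rintro ⟨f, hf⟩ h
  have hi : ∀ i : Fin 4, f i.castSucc = 1 := fun i => congrFun h i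
  have h4 : ∏ i, f i = 1 := hf
  rw [Fin.prod_univ_castSucc, Finset.prod_eq_one (fun i _ => hi i), one_mul] at h4
  ext i
  induction i using Fin.lastCases with
  | last => exact h4
  | cast i => exact hi i

theorem subsetCoords_orbit (i : Fin 4) : ∃ σ, subsetCoords
    (restrictAut mulAutArrow evenSubsets evenSubsets_invariant σ firstPair) =
      Pi.mulSingle i (.ofAdd 1) := by
  -- This permutation carries `{0, 1}` to `{i, 4}`, and the point `4` is not among the coordinates.
  refine ⟨swap 0 i.castSucc * swap 1 4, ?_⟩
  revert i
  decide +kernel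

theorem closure_subsetGens : Subgroup.closure (Set.range subsetGens) = ⊤ := by
  refine eq_top_of_prod _ _ ?_ ?_
  · rw [map_closure_range]
    refine eq_top_of_orbit mul_comm _ ?_ firstPair ?_ subsetCoords subsetCoords_injective
      subsetCoords_orbit
    · rw [map_closure_range]
      -- The permutation parts of `y` and `z` multiply to a 5-cycle.
      exact closure_perm_five _ (mem_closure_range _ .x)
        (wordProd_mem_closure _ [.y, .z]) (by decide +kernel) (by decide +kernel)
    · exact mem_closure_of_wordProd
        [.x, .y, .z, .x, .z, .y, .z, .x, .z, .y, .z, .x, .z] (by decide +kernel)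
  · have h : (Multiplicative.ofAdd 1, 1) ∈ Subgroup.closure (Set.range subsetGens) :=
      mem_closure_of_wordProd
        [.x, .y, .z, .x, .y, .z, .x, .y, .z, .x, .y, .z, .y, .z, .x, .y, .z, .x, .y, .z, .x, .y,
          .z, .x, .z, .y, .z, .x, .y, .z, .x, .y, .z, .y, .z] (by decide +kernel)
    intro c
    rcases (by decide : ∀ c : Cyc 2, c = 1 ∨ c = .ofAdd 1) c with rfl | rfl
    exacts [Subgroup.one_mem _, h]

theorem card_twoPowFourSymm : Nat.card (Cyc 2 × TwoPowFourSymm) = 3840 := by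
  rw [Nat.card_prod, SemidirectProduct.card,
    card_eq_of_orbit firstPair subsetCoords subsetCoords_injective subsetCoords_orbit,
    Nat.card_perm, Nat.card_fin, Nat.card_fin, show Nat.card (Cyc 2) = 2 from Nat.card_zmod 2]
  rfl

/-! #### The group `2 × (2 ^ 6 : S_5)` -/

/-- The triangle with vertices `0`, `1`, `4`, as an even subgraph. -/
def triangle : evenSubgraphs :=
  ⟨fun p => if p ∈ [(0, 1), (1, 0), (0, 4), (4, 0), (1, 4), (4, 1)] then .ofAdd 1 else 1, by
    change (∀ i j : Fin 5, _) ∧ (∀ i : Fin 5, _) ∧ ∀ i : Fin 5, _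
    decide +kernel⟩

/-- Generators of `2 × (2 ^ 6 : S_5)`. -/
def subgraphGens : Gen → Cyc 2 × TwoPowSixSymm :=
  triple (1, .inr (swap 0 1)) (1, ⟨triangle, swap 2 3⟩) (.ofAdd 1, .inr (swap 0 4 * swap 1 2))

theorem satisfies_subgraphGens : Satisfies subgraphGens
    (relations 6 [(xzyz, 6), (xzyzyz, 6), (xyzyxz, 5), (xyzyzyxz, 4)]) := by
  refine satisfies_triple ?_ ?_ ?_ ?_ <;> decide +kernel

/-- The six edges between the first four vertices. -/
def edge : Fin 6 → Fin 5 × Fin 5 := ![(0, 1), (0, 2), (0, 3), (1, 2), (1, 3), (2, 3)]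

/-- The coordinates of an even subgraph at the edges between the first four vertices. -/
def subgraphCoords : evenSubgraphs →* (Fin 6 → Cyc 2) where
  toFun f i := (f : Fin 5 × Fin 5 → Cyc 2) (edge i)
  map_one' := rfl
  map_mul' _ _ := rfl

/-- The edges to the last vertex are determined by the even degrees at their other ends. -/
theorem subgraphCoords_injective : Function.Injective subgraphCoords := by
  rw [injective_iff_map_eq_one]
  rintro ⟨f, hsymm, hdiag, heven⟩ h
  have hi : ∀ i, f (edge i) = 1 := fun i => congrFun h i
  have h4 : ∀ i j : Fin 4, f (i.castSucc, j.castSucc) = 1 := by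
    intro i j
    rcases (by decide : ∀ i j : Fin 4, i = j ∨
      (∃ k, edge k = (i.castSucc, j.castSucc)) ∨ ∃ k, edge k = (j.castSucc, i.castSucc)) i j with
      rfl | ⟨k, hk⟩ | ⟨k, hk⟩
    · exact hdiag _
    · rw [← hk, hi]
    · rw [hsymm, ← hk, hi]
  have hlast : ∀ i : Fin 4, f (i.castSucc, Fin.last 4) = 1 := by
    intro i
    have := heven i.castSucc
    rwa [Fin.prod_univ_castSucc, Finset.prod_eq_one (fun j _ => h4 i j), one_mul] at this
  ext ⟨i, j⟩
  induction i using Fin.lastCases with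
  | last =>
    induction j using Fin.lastCases with
    | last => exact hdiag _
    | cast j => exact (hsymm _ _).trans (hlast j)
  | cast i =>
    induction j using Fin.lastCases with
    | last => exact hlast i
    | cast j => exact h4 i j

theorem subgraphCoords_orbit (i : Fin 6) : ∃ σ, subgraphCoords
    (restrictAut mulAutArrow evenSubgraphs evenSubgraphs_invariant σ triangle) =
      Pi.mulSingle i (.ofAdd 1) := by
  -- The permutations carry the triangle `0, 1, 4` to the triangle formed by the `i`-th edge and the
  -- vertex `4`; its other two edges are not among the coordinates.
  refine ⟨![1, swap 1 2, swap 1 3, swap 0 2, swap 0 3, swap 0 2 * swap 1 3] i, ?_⟩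
  revert i
  decide +kernel

theorem closure_subgraphGens : Subgroup.closure (Set.range subgraphGens) = ⊤ := by
  refine eq_top_of_prod _ _ ?_ ?_
  · rw [map_closure_range]
    refine eq_top_of_orbit mul_comm _ ?_ triangle ?_ subgraphCoords subgraphCoords_injective
      subgraphCoords_orbit
    · rw [map_closure_range]
      exact closure_perm_five _ (mem_closure_range _ .x)
        (wordProd_mem_closure _ [.x, .y, .z]) (by decide +kernel) (by decide +kernel)
    · exact mem_closure_of_wordProd
        [.x, .y, .z, .y, .z, .y, .z, .x, .z, .y, .z, .y, .z, .x, .z, .y, .z, .y, .z]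
        (by decide +kernel)
  · have h : (Multiplicative.ofAdd 1, 1) ∈ Subgroup.closure (Set.range subgraphGens) :=
      mem_closure_of_wordProd
        [.x, .y, .z, .x, .y, .z, .x, .z, .y, .z, .x, .y, .z, .x, .z, .y, .z, .x, .y, .z, .x, .z,
          .y, .z, .x, .y, .z, .x, .z, .y, .z, .y, .z, .x, .z] (by decide +kernel)
    intro c
    rcases (by decide : ∀ c : Cyc 2, c = 1 ∨ c = .ofAdd 1) c with rfl | rfl
    exacts [Subgroup.one_mem _, h]

theorem card_twoPowSixSymm : Nat.card (Cyc 2 × TwoPowSixSymm) = 15360 := by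
  rw [Nat.card_prod, SemidirectProduct.card,
    card_eq_of_orbit triangle subgraphCoords subgraphCoords_injective subgraphCoords_orbit,
    Nat.card_perm, Nat.card_fin, Nat.card_fin, show Nat.card (Cyc 2) = 2 from Nat.card_zmod 2]
  rfl

/-! #### The group `3 ^ 4 : (D_8 × S_3)` -/

theorem closure_perm_three (K : Subgroup (Perm (Fin 3))) (h0 : swap 0 1 ∈ K)
    (h1 : swap 1 2 ∈ K) : K = ⊤ := by
  rw [eq_top_iff]
  intro σ _
  rcases (by decide +kernel : ∀ σ : Perm (Fin 3), σ = 1 ∨ σ = swap 0 1 ∨ σ = swap 1 2 ∨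
    σ = swap 0 1 * swap 1 2 ∨ σ = swap 1 2 * swap 0 1 ∨ σ = swap 0 1 * swap 1 2 * swap 0 1) σ with
    rfl | rfl | rfl | rfl | rfl | rfl
  exacts [K.one_mem, h0, h1, K.mul_mem h0 h1, K.mul_mem h1 h0,
    K.mul_mem (K.mul_mem h0 h1) h0]

/-- The tensor product of a function on the square supported on one diagonal and a function on three
points. -/
def pureTensor : oddSumZero :=
  ⟨fun p => if p = (0, 1) ∨ p = (2, 2) then .ofAdd 1 else
    if p = (0, 2) ∨ p = (2, 1) then .ofAdd 2 else 1, by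
    change (∀ (k : ZMod 4) (j : Fin 3), _) ∧ ∀ k : ZMod 4, _
    decide +kernel⟩

/-- Generators of `3 ^ 4 : (D_8 × S_3)`. -/
def tensorGens : Gen → ThreePowFour :=
  triple (.inr (.sr 0, 1)) ⟨pureTensor, (1, swap 1 2)⟩ (.inr (.sr 1, swap 0 1))

theorem satisfies_tensorGens : Satisfies tensorGens
    (relations 6 [(xzyz, 6), (xzyzyz, 4), (xyzyxz, 6), (xyzyzyxzyz, 6)]) := by
  refine satisfies_triple ?_ ?_ ?_ ?_ <;> decide +kernel

/-- Four points at which the elements of `3 ^ 4` can take arbitrary values. -/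
def cell : Fin 4 → ZMod 4 × Fin 3 := ![(0, 0), (0, 1), (1, 0), (1, 1)]

/-- The coordinates of an element of `3 ^ 4`. -/
def tensorCoords : oddSumZero →* (Fin 4 → Cyc 3) where
  toFun f i := (f : ZMod 4 × Fin 3 → Cyc 3) (cell i)
  map_one' := rfl
  map_mul' _ _ := rfl

/-- The zero sum gives the value at the third point, and the sign rule for opposite vertices gives
the other half of the square. -/
theorem tensorCoords_injective : Function.Injective tensorCoords := by
  rw [injective_iff_map_eq_one]
  rintro ⟨f, hodd, hsum⟩ h
  have hi : ∀ i, f (cell i) = 1 := fun i => congrFun h i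
  have h2 : ∀ k : ZMod 4, f (k, 0) = 1 → f (k, 1) = 1 → ∀ j, f (k, j) = 1 := by
    intro k h0 h1 j
    have h2 := hsum k
    rw [Fin.prod_univ_three, h0, h1, one_mul, one_mul] at h2
    fin_cases j <;> assumption
  have h0 := h2 0 (hi 0) (hi 1)
  have h1 := h2 1 (hi 2) (hi 3)
  ext ⟨k, j⟩
  rcases (by decide : ∀ k : ZMod 4, k = 0 ∨ k = 1 ∨ k = 0 + 2 ∨ k = 1 + 2) k with
    rfl | rfl | rfl | rfl
  · exact h0 j
  · exact h1 j
  · exact (hodd 0 j).trans (by rw [h0 j, inv_one]; rfl)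
  · exact (hodd 1 j).trans (by rw [h1 j, inv_one]; rfl)

theorem tensorCoords_orbit (i : Fin 4) : ∃ g, tensorCoords
    (restrictAut mulAutArrow oddSumZero oddSumZero_invariant g pureTensor) =
      Pi.mulSingle i (.ofAdd 1) := by
  -- `pureTensor` is already the unit vector at the cell `(0, 1)`. The rotation moves the vertex `0`
  -- to `1`, and the transposition moves the point `1` to `0`.
  refine ⟨![(1, swap 0 1), 1, (.r 1, swap 0 1), (.r 1, 1)] i, ?_⟩
  revert i
  decide +kernel

theorem closure_tensorGens : Subgroup.closure (Set.range tensorGens) = ⊤ := by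
  refine eq_top_of_orbit mul_comm _ ?_ pureTensor ?_ tensorCoords tensorCoords_injective
    tensorCoords_orbit
  · rw [map_closure_range]
    refine eq_top_of_prod _ _ ?_ ?_
    · rw [map_closure_range]
      exact closure_perm_three _ (mem_closure_range _ .z) (mem_closure_range _ .y)
    · intro c
      have := closure_dihedral 4 ((Subgroup.closure (Set.range
        (SemidirectProduct.rightHom ∘ tensorGens))).comap (MonoidHom.inl _ _))
        (mem_closure_range _ .x)
        -- In `(yz)³` the 3-cycle disappears, and the reflection `sr 1` remains since `y` is trivial
        -- in `D_8`.
        (mem_closure_of_wordProd [.y, .z, .y, .z, .y, .z] (by decide +kernel))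
      have hc : c ∈ (⊤ : Subgroup (DihedralGroup 4)) := Subgroup.mem_top c
      rwa [← this] at hc
  -- This is the square of `zxz · y`. Both `zxz` and the transposition in `y` negate `pureTensor`,
  -- so written additively the result is `-2` times it, which is `pureTensor` again.
  · exact mem_closure_of_wordProd [.z, .x, .z, .y, .z, .x, .z, .y] (by decide +kernel)

theorem card_threePowFour : Nat.card ThreePowFour = 3888 := by
  rw [SemidirectProduct.card,
    card_eq_of_orbit pureTensor tensorCoords tensorCoords_injective tensorCoords_orbit,
    Nat.card_prod, Nat.card_perm, Nat.card_fin, Nat.card_fin, DihedralGroup.nat_card]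
  rfl

/-! #### The group `(S_4 × S_4) : 2 ^ 2` -/

/-- Conjugation by `h` carries the first factor `A` to the second, so it suffices that `K` contains
the first. -/
theorem eq_top_of_inl_inl_mem {A H : Type*} [Group A] [Group H] {φ : H →* MulAut (A × A)}
    (K : Subgroup ((A × A) ⋊[φ] H)) (hH : K.map SemidirectProduct.rightHom = ⊤)
    {h : H} (hh : SemidirectProduct.inr h ∈ K) (hswap : φ h = swapAut A)
    (hA : ∀ a : A, SemidirectProduct.inl (a, 1) ∈ K) : K = ⊤ := by
  refine eq_top_of_inl_mem K hH ?_
  rintro ⟨a, b⟩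
  have hb : SemidirectProduct.inl (φ h (b, 1)) ∈ K := by
    rw [SemidirectProduct.inl_aut]
    exact K.mul_mem (K.mul_mem hh (hA b)) (by rw [map_inv]; exact K.inv_mem hh)
  rw [hswap] at hb
  have : (a, b) = (a, 1) * swapAut A (b, 1) := by simp [swapAut]
  rw [this, map_mul]
  exact K.mul_mem (hA a) hb

theorem closure_perm_four (K : Subgroup (Perm (Fin 4))) (h : ∀ i : Fin 4, swap i 3 ∈ K) :
    K = ⊤ := by
  rw [eq_top_iff, ← Perm.closure_isSwap, Subgroup.closure_le]
  rintro _ ⟨i, j, -, rfl⟩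
  by_cases hij : i = j
  · rw [hij, swap_self]
    exact K.one_mem
  by_cases hi : i = 3
  · rw [hi, swap_comm]
    exact h j
  by_cases hj : j = 3
  · rw [hj]
    exact h i
  have : swap i j = swap i 3 * swap j 3 * swap i 3 := by
    revert i j
    decide +kernel
  rw [this]
  exact K.mul_mem (K.mul_mem (h i) (h j)) (h i)

theorem closure_klein (K : Subgroup (Cyc 2 × Cyc 2)) (h0 : (.ofAdd 1, 1) ∈ K)
    (h1 : (1, .ofAdd 1) ∈ K) : K = ⊤ := by
  rw [eq_top_iff]
  intro c _
  rcases (by decide +kernel : ∀ c : Cyc 2 × Cyc 2, c = 1 ∨ c = (.ofAdd 1, 1) ∨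
    c = (1, .ofAdd 1) ∨ c = (.ofAdd 1, 1) * (1, .ofAdd 1)) c with rfl | rfl | rfl | rfl
  exacts [K.one_mem, h0, h1, K.mul_mem h0 h1]

/-- Generators of `(S_4 × S_4) : 2 ^ 2`. -/
def symmSqGens : Gen → SymmFourSq :=
  triple (.inl (1, swap 2 3)) ⟨(swap 1 2, swap 0 1), (1, .ofAdd 1)⟩ (.inr (.ofAdd 1, 1))

theorem satisfies_symmSqGens : Satisfies symmSqGens
    (relations 6 [(xzyz, 6), (xzyzyz, 4), (xyzyxz, 4)]) := by
  refine satisfies_triple ?_ ?_ ?_ ?_ <;> decide +kernel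

theorem closure_symmSqGens : Subgroup.closure (Set.range symmSqGens) = ⊤ := by
  refine eq_top_of_inl_inl_mem _ ?_ (mem_closure_range symmSqGens .z)
    (MulEquiv.ext fun _ => rfl) fun a => ?_
  · rw [map_closure_range]
    exact closure_klein _ (mem_closure_range _ .z) (mem_closure_range _ .y)
  -- In the first factor, `zxz` is `(2 3)`; conjugation by `y` gives `(1 3)`, and conjugation of
  -- that by `zyz` gives `(0 3)`. For `i = 3` the transposition degenerates to `1`, the empty word.
  · have := closure_perm_four ((Subgroup.closure (Set.range symmSqGens)).comap
      (SemidirectProduct.inl.comp (MonoidHom.inl _ _))) fun i => mem_closure_of_wordProd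
        (![[.z, .y, .z, .y, .z, .x, .z, .y, .z, .y, .z], [.y, .z, .x, .z, .y], [.z, .x, .z],
          []] i) (by revert i; decide +kernel)
    have ha : a ∈ (⊤ : Subgroup (Perm (Fin 4))) := Subgroup.mem_top a
    rwa [← this] at ha

theorem card_symmFourSq : Nat.card SymmFourSq = 2304 := by
  rw [SemidirectProduct.card, Nat.card_prod, Nat.card_prod, Nat.card_perm, Nat.card_fin,
    show Nat.card (Cyc 2) = 2 from Nat.card_zmod 2]
  rfl

/-! #### The group `(A_5 × A_5) : 2 ^ 2` -/

/-- The product of two transpositions, as an even permutation. -/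
def twoSwaps (i j k l : Fin 5) (h : i ≠ j ∧ k ≠ l) : alternatingGroup (Fin 5) :=
  ⟨swap i j * swap k l, by
    rw [Perm.mem_alternatingGroup, map_mul, Perm.sign_swap h.1, Perm.sign_swap h.2]
    rfl⟩

/-- Generators of `(A_5 × A_5) : 2 ^ 2`. -/
def altSqGens : Gen → AltFiveSq :=
  triple (.inr (.ofAdd 1, 1))
    ⟨(twoSwaps 1 2 3 4 (by decide), twoSwaps 1 2 3 4 (by decide)), (.ofAdd 1, 1)⟩
    ⟨(1, twoSwaps 0 1 2 3 (by decide)), (1, .ofAdd 1)⟩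

theorem satisfies_altSqGens : Satisfies altSqGens
    (relations 6 [(xzyz, 5), (xzyzyz, 6), (xyzyxz, 6)]) := by
  refine satisfies_triple ?_ ?_ ?_ ?_ <;> decide +kernel

/-- Three `3`-cycles generating the alternating group of degree five. -/
def altGens : Gen → alternatingGroup (Fin 5) :=
  triple (twoSwaps 0 1 0 2 (by decide)) (twoSwaps 0 1 0 3 (by decide))
    (twoSwaps 0 4 0 2 (by decide))

theorem closure_altGens : Subgroup.closure (Set.range altGens) = ⊤ := by
  rw [eq_top_iff]
  intro σ _
  -- A chain of point stabilizers: `u` puts `4` in place, `v` fixes `4` and puts `3` in place, and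
  -- `w` is a power of the 3-cycle on the remaining points. The intermediate conditions prune the
  -- search.
  have h : ∀ σ : Perm (Fin 5), Perm.sign σ = 1 →
      ∃ u ∈ [[.z], [.x, .x, .z], [.z, .z], [.y, .z], []],
        (wordProd altGens u).1 4 = σ 4 ∧
      ∃ v ∈ [[.y, .y], [.y], [.x, .y, .y], []],
        (wordProd altGens (u ++ v)).1 3 = σ 3 ∧
      ∃ w ∈ [[], [.x], [.x, .x]], wordProd altGens (u ++ v ++ w) = σ := by
    decide +kernel
  obtain ⟨u, -, -, v, -, -, w, -, hw⟩ := h σ (Perm.mem_alternatingGroup.mp σ.2)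
  exact mem_closure_of_wordProd _ (Subtype.ext hw)

theorem closure_altSqGens : Subgroup.closure (Set.range altSqGens) = ⊤ := by
  refine eq_top_of_inl_inl_mem _ ?_ (mem_closure_range altSqGens .x)
    (MulEquiv.ext fun _ => rfl) fun a => ?_
  · rw [map_closure_range]
    exact closure_klein _ (mem_closure_range _ .x) (mem_closure_range _ .z)
  · have h : Subgroup.closure (Set.range altGens) ≤ (Subgroup.closure (Set.range altSqGens)).comap
        (SemidirectProduct.inl.comp (MonoidHom.inl _ _)) := by
      rw [Subgroup.closure_le]
      rintro _ ⟨s, rfl⟩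
      refine mem_closure_of_wordProd (triple
        [.x, .y, .z, .x, .y, .z, .x, .y, .z, .x, .y, .z]
        [.x, .z, .y, .z, .x, .y, .z, .x, .y, .z, .y, .z, .x, .z]
        [.x, .y, .z, .x, .z, .y, .z, .x, .y, .z, .x, .y, .z, .y, .z, .y] s) ?_
      cases s <;> decide +kernel
    rw [closure_altGens] at h
    exact h (Subgroup.mem_top a)

theorem card_altFiveSq : Nat.card AltFiveSq = 14400 := by
  have h : 2 * Nat.card (alternatingGroup (Fin 5)) = 120 := by
    rw [nat_card_alternatingGroup, Nat.card_fin]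
    rfl
  rw [SemidirectProduct.card, Nat.card_prod, Nat.card_prod,
    show Nat.card (alternatingGroup (Fin 5)) = 60 by omega,
    show Nat.card (Cyc 2) = 2 from Nat.card_zmod 2]

end

end SixTransposition

namespace SixTransposition

open Matrix

/-! #### The group `PGL(2, 9)` -/

/-- The field of nine elements, in a form in which the kernel can compute. -/
abbrev Nine : Type := QuadraticAlgebra (ZMod 3) (-1) 0

instance : Fact (∀ r : ZMod 3, r ^ 2 ≠ -1 + 0 * r) := ⟨by decide⟩

theorem card_nine : Nat.card Nine = 9 := by
  rw [Nat.card_congr (QuadraticAlgebra.equivProd _ _), Nat.card_prod, Nat.card_zmod]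

/-- As 9 is not 3 modulo 4, `-1` has a square root in `GaloisField 3 2`. Sending the generator of
`Nine` to it gives an injection between fields of equal size. -/
theorem exists_nine_ringEquiv : Nonempty (Nine ≃+* GaloisField 3 2) := by
  have hK : Nat.card (GaloisField 3 2) = 9 := GaloisField.card 3 2 two_ne_zero
  have : Fintype (GaloisField 3 2) := Fintype.ofFinite _
  have hs : IsSquare (-1 : GaloisField 3 2) := by
    rw [FiniteField.isSquare_neg_one_iff, ← Nat.card_eq_fintype_card, hK]
    decide
  obtain ⟨i, hi⟩ := hs
  let f := QuadraticAlgebra.lift (R := ZMod 3) (a := -1) (b := 0) ⟨i, by rw [← hi]; simp⟩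
  have hf : Function.Bijective f :=
    Function.Injective.bijective_of_nat_card_le f.toRingHom.injective
      (by rw [hK, card_nine])
  exact ⟨RingEquiv.ofBijective f hf⟩

/-- The image of a matrix over the field of nine elements in `PGL(2, 9)`. -/
noncomputable def toPGL : GL (Fin 2) Nine →* PGLTwoNine :=
  ProjGenLinGroup.mk.comp (GeneralLinearGroup.map
    (Classical.choice exists_nine_ringEquiv).toRingHom)

theorem toPGL_surjective : Function.Surjective toPGL := by
  refine ProjGenLinGroup.mk_surjective.comp fun g => ?_
  refine ⟨GeneralLinearGroup.map
    (Classical.choice exists_nine_ringEquiv).symm.toRingHom g, ?_⟩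
  ext i j
  simp

theorem toPGL_eq_one {g : GL (Fin 2) Nine} (hg : g.val ∈ Set.range (scalar (Fin 2))) :
    toPGL g = 1 :=
  ProjGenLinGroup.mk_eq_one.mpr (GeneralLinearGroup.map_center_le _
    (GeneralLinearGroup.mem_center_iff_val_mem_range_scalar.mpr hg))

/-- Matrices that generate `PGL(2, 9)`. -/
def matrixGens : Gen → GL (Fin 2) Nine :=
  triple
    ⟨!![0, 1; ⟨1, 1⟩, 0], !![0, ⟨-1, 1⟩; 1, 0], by decide +kernel, by decide +kernel⟩
    ⟨!![0, 1; ⟨-1, -1⟩, 0], !![0, ⟨1, -1⟩; 1, 0], by decide +kernel, by decide +kernel⟩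
    ⟨!![1, 1; ⟨0, 1⟩, -1], !![⟨-1, 1⟩, ⟨-1, 1⟩; ⟨-1, -1⟩, ⟨1, -1⟩],
      by decide +kernel, by decide +kernel⟩

/-- Generators of `PGL(2, 9)`. -/
noncomputable def pglGens : Gen → PGLTwoNine :=
  triple (toPGL (matrixGens .x)) (toPGL (matrixGens .y)) (toPGL (matrixGens .z))

theorem toPGL_wordProd (w : List Gen) : toPGL (wordProd matrixGens w) = wordProd pglGens w := by
  rw [wordProd, wordProd, map_list_prod, List.map_map]
  congr 2
  funext s
  cases s <;> rfl

theorem wordProd_pglGens_pow {w : List Gen} {n : ℕ} {c : Nine}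
    (h : (wordProd matrixGens w).val ^ n = scalar (Fin 2) c) : wordProd pglGens w ^ n = 1 := by
  rw [← toPGL_wordProd, ← map_pow]
  exact toPGL_eq_one ⟨c, h.symm⟩

theorem satisfies_pglGens : Satisfies pglGens (relations 5 [(xzyz, 5)]) := by
  have h (s : Gen) : toPGL (matrixGens s) * toPGL (matrixGens s) = 1 := by
    rw [← map_mul]
    refine toPGL_eq_one ⟨triple ⟨1, 1⟩ ⟨-1, -1⟩ ⟨1, 1⟩ s, ?_⟩
    cases s <;> decide +kernel
  refine satisfies_triple (h _) (h _) (h _) ?_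
  exact ⟨wordProd_pglGens_pow (c := ⟨0, -1⟩) (by decide +kernel),
    wordProd_pglGens_pow (c := 1) (by decide +kernel),
    wordProd_pglGens_pow (c := ⟨-1, 1⟩) (by decide +kernel),
    wordProd_pglGens_pow (c := -1) (by decide +kernel)⟩

/-- The matrices whose images in `PGL(2, 9)` lie in the subgroup generated by `pglGens`. -/
noncomputable def spanned : Submonoid (Matrix (Fin 2) (Fin 2) Nine) :=
  ((Subgroup.closure (Set.range pglGens)).comap toPGL).toSubmonoid.map (Units.coeHom _)

theorem scalar_mem_spanned {c : Nine} (hc : c ≠ 0) : scalar (Fin 2) c ∈ spanned := by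
  refine ⟨GeneralLinearGroup.scalar (Fin 2) (Units.mk0 c hc), ?_, rfl⟩
  change toPGL _ ∈ Subgroup.closure _
  rw [toPGL_eq_one ⟨c, rfl⟩]
  exact Subgroup.one_mem _

theorem mem_spanned_of_wordProd {M : Matrix (Fin 2) (Fin 2) Nine} (w : List Gen) (c : Nine)
    (hc : c ≠ 0) (h : scalar (Fin 2) c * (wordProd matrixGens w).val = M) : M ∈ spanned := by
  rw [← h]
  refine mul_mem (scalar_mem_spanned hc) ⟨wordProd matrixGens w, ?_, rfl⟩
  change toPGL _ ∈ Subgroup.closure _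
  rw [toPGL_wordProd]
  exact wordProd_mem_closure _ _

theorem upper_mem_spanned (t : Nine) : !![1, t; 0, 1] ∈ spanned := by
  have h1 : !![1, 1; 0, 1] ∈ spanned := mem_spanned_of_wordProd
    [.x, .y, .z, .x, .y, .z, .x, .z, .y, .z] ⟨1, 1⟩ (by decide +kernel) (by decide +kernel)
  have hi : !![1, ⟨0, 1⟩; 0, 1] ∈ spanned := mem_spanned_of_wordProd
    [.z, .x, .y, .z, .y, .z, .x, .y, .z, .x, .y, .z, .y, .z] ⟨-1, 1⟩ (by decide +kernel)
    (by decide +kernel)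
  obtain ⟨a, b⟩ := t
  have : ∀ a b : ZMod 3, (!![1, ⟨a, b⟩; 0, 1] : Matrix (Fin 2) (Fin 2) Nine) =
      -- The elements `1` and `i` generate the additive group of the field, and upper unitriangular
      -- matrices multiply by adding their corners.
      !![1, 1; 0, 1] ^ a.val * !![1, ⟨0, 1⟩; 0, 1] ^ b.val := by
    decide +kernel
  rw [this]
  exact mul_mem (pow_mem h1 _) (pow_mem hi _)

theorem lower_mem_spanned (t : Nine) : !![1, 0; t, 1] ∈ spanned := by
  have hx : !![0, 1; ⟨1, 1⟩, 0] ∈ spanned :=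
    mem_spanned_of_wordProd [.x] 1 one_ne_zero (by decide +kernel)
  have hy : !![0, ⟨-1, 1⟩; 1, 0] ∈ spanned :=
    mem_spanned_of_wordProd [.x] ⟨-1, 1⟩ (by decide +kernel) (by decide +kernel)
  obtain ⟨a, b⟩ := t
  -- The matrix of `x` interchanges the coordinate axes, so conjugation by it turns upper
  -- transvections into lower ones; `⟨-1, 1⟩` is the inverse of `1 + i`.
  have : ∀ a b : ZMod 3, (!![1, 0; ⟨a, b⟩, 1] : Matrix (Fin 2) (Fin 2) Nine) =
      !![0, 1; ⟨1, 1⟩, 0] * !![1, ⟨-1, 1⟩ * ⟨a, b⟩; 0, 1] * !![0, ⟨-1, 1⟩; 1, 0] := by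
    decide +kernel
  rw [this]
  exact mul_mem (mul_mem hx (upper_mem_spanned _)) hy

theorem diagonal_mem_spanned {t : Nine} (ht : t ≠ 0) : !![1, 0; 0, t] ∈ spanned := by
  have h1 : !![1, 0; 0, ⟨1, 1⟩] ∈ spanned := mem_spanned_of_wordProd
    [.z, .x, .y, .z, .x, .y, .z, .x, .y, .z, .y] ⟨1, 1⟩ (by decide +kernel) (by decide +kernel)
  obtain ⟨a, b⟩ := t
  -- The element `1 + i` generates the multiplicative group, which has order 8.
  have : ∀ a b : ZMod 3, (⟨a, b⟩ : Nine) ≠ 0 → ∃ k : Fin 8,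
      (!![1, 0; 0, ⟨a, b⟩] : Matrix (Fin 2) (Fin 2) Nine) = !![1, 0; 0, ⟨1, 1⟩] ^ k.val := by
    decide +kernel
  obtain ⟨k, hk⟩ := this a b ht
  rw [hk]
  exact pow_mem h1 _

/-- Gaussian elimination reduces an invertible matrix to transvections and diagonal matrices, and
the latter are covered by `diag(1, t)` up to scalars. -/
theorem mem_spanned {M : Matrix (Fin 2) (Fin 2) Nine} (hM : M.det ≠ 0) : M ∈ spanned := by
  refine diagonal_transvection_induction_of_det_ne_zero (· ∈ spanned) M hM ?_ ?_
    fun A B _ _ => mul_mem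
  · intro d hd
    rw [det_diagonal, Fin.prod_univ_two] at hd
    have h0 : d 0 ≠ 0 := left_ne_zero_of_mul hd
    have h1 : d 1 ≠ 0 := right_ne_zero_of_mul hd
    have : diagonal d = scalar (Fin 2) (d 0) * !![1, 0; 0, d 1 / d 0] := by
      refine Matrix.ext fun i j => ?_
      fin_cases i <;> fin_cases j <;> simp [mul_div_cancel₀, h0]
    rw [this]
    exact mul_mem (scalar_mem_spanned h0) (diagonal_mem_spanned (div_ne_zero h1 h0))
  · rintro ⟨i, j, hij, c⟩
    rcases (by decide : ∀ i j : Fin 2, i ≠ j → i = 0 ∧ j = 1 ∨ i = 1 ∧ j = 0) i j hij with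
      ⟨rfl, rfl⟩ | ⟨rfl, rfl⟩
    · convert upper_mem_spanned c using 1
      refine Matrix.ext fun i j => ?_
      fin_cases i <;> fin_cases j <;> simp [TransvectionStruct.toMatrix, transvection]
    · convert lower_mem_spanned c using 1
      refine Matrix.ext fun i j => ?_
      fin_cases i <;> fin_cases j <;> simp [TransvectionStruct.toMatrix, transvection]

theorem closure_pglGens : Subgroup.closure (Set.range pglGens) = ⊤ := by
  rw [eq_top_iff]
  intro g _
  obtain ⟨g, rfl⟩ := toPGL_surjective g
  obtain ⟨g', hg', h⟩ := mem_spanned (GeneralLinearGroup.det_ne_zero g)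
  rw [← Units.ext (show g'.val = g.val from h)]
  exact hg'

theorem card_pglTwoNine : Nat.card PGLTwoNine = 720 := by
  have hK : Nat.card (GaloisField 3 2) = 9 := GaloisField.card 3 2 two_ne_zero
  have : Fintype (GaloisField 3 2) := Fintype.ofFinite _
  have hG : Nat.card (GL (Fin 2) (GaloisField 3 2)) = 5760 := by
    rw [card_GL_field, ← Nat.card_eq_fintype_card, hK]
    rfl
  have hZ : Nat.card (Subgroup.center (GL (Fin 2) (GaloisField 3 2))) = 8 := by
    rw [GeneralLinearGroup.center_eq_range_scalar]
    rw [← Nat.card_congr (MonoidHom.ofInjective (f := GeneralLinearGroup.scalar (Fin 2))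
      fun a b hab => ?_).toEquiv, Nat.card_units, hK]
    have h00 := congrArg (fun g : GL (Fin 2) (GaloisField 3 2) => g.val 0 0) hab
    exact Units.ext (by simpa using h00)
  have := Subgroup.card_eq_card_quotient_mul_card_subgroup
    (Subgroup.center (GL (Fin 2) (GaloisField 3 2)))
  rw [hG, hZ] at this
  have h : Nat.card PGLTwoNine =
    Nat.card (GL (Fin 2) (GaloisField 3 2) ⧸ Subgroup.center _) := rfl
  omega

end SixTransposition

namespace SixTransposition

/-! ### Coset enumerations -/

section

variable {G : Type*} [Group G] {g : Gen → G}

/-- A certificate for the presentation of `2 ^ 5 : D_{10}`. -/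
def twoPowDihedralFiveCertificate : CardCertificate where
  sub := triple [.y] [.y] [.z]
  subRelations := [([.x, .y], 1), ([.y, .z], 5)]
  index := 32
  card := 10
  relationScans :=
    [(1, 5)]
  indexScans :=
    [(1, 3), (2, 5), (6, 3), (4, 3), (1, 6), (5, 4), (18, 3), (7, 4), (12, 5), (5, 6), (31, 3),
     (32, 4), (29, 3), (22, 4), (16, 6), (30, 5), (14, 5), (4, 6), (38, 3), (19, 5), (22, 6),
     (41, 4), (31, 6)]
  cardScans :=
    [(1, 3), (1, 4), (10, 3), (7, 3), (3, 3), (5, 3)]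

/-- The subgroup is `⟨y, z⟩`, of order at most 10; `y` is listed twice because three words are
required. The relations make `x` commute with its conjugates at distances 1 and 2 on the pentagon.
In a scan list, `(c, k)` applies the relator at position `k` to the coset `c`: positions 0 to 2 are
the squares of the generators, and the given relations follow from position 3 on. -/
theorem isQuotientOf_twoPowDihedralFive
    (hg : Satisfies g (relations 5 [(xzyz, 4)]))
    (hgen : Subgroup.closure (Set.range g) = ⊤) : IsQuotientOf G (TwoPowDihedral 5) :=
  isQuotientOf_of_check hg hgen satisfies_dihedralGens_five (closure_dihedralGens 5)
    twoPowDihedralFiveCertificate (by decide +kernel) (by rw [card_twoPowDihedral 5]; decide)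

/-- A certificate for the presentation of `2 ^ 6 : D_{12}`. -/
def twoPowDihedralSixCertificate : CardCertificate where
  sub := triple [.y] [.y] [.z]
  subRelations := [([.x, .y], 1), ([.y, .z], 6)]
  index := 64
  card := 12
  relationScans :=
    [(1, 5)]
  indexScans :=
    [(1, 3), (1, 4), (4, 3), (9, 4), (1, 6), (4, 6), (10, 3), (15, 3), (2, 5), (20, 3), (19, 4),
     (1, 7), (14, 5), (5, 5), (34, 3), (9, 6), (4, 7), (28, 4), (17, 4), (13, 6), (45, 3), (11, 5),
     (50, 3), (35, 4), (54, 3), (38, 5), (9, 7), (60, 3), (17, 6), (27, 6), (61, 4), (19, 6),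
     (13, 7), (27, 7), (59, 4), (49, 4), (40, 6), (41, 7), (17, 7), (49, 6), (40, 7), (65, 6),
     (71, 7)]
  cardScans :=
    [(1, 3), (1, 4), (9, 3), (3, 3), (7, 3), (5, 3), (12, 3)]

/-- In the hexagon there are also pairs at distance 3, which is why the relation for `xzyzyz` is
needed besides that for `xzyz`. -/
theorem isQuotientOf_twoPowDihedralSix
    (hg : Satisfies g (relations 6 [(xzyz, 4), (xzyzyz, 4)]))
    (hgen : Subgroup.closure (Set.range g) = ⊤) : IsQuotientOf G (TwoPowDihedral 6) :=
  isQuotientOf_of_check hg hgen satisfies_dihedralGens_six (closure_dihedralGens 6)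
    twoPowDihedralSixCertificate (by decide +kernel) (by rw [card_twoPowDihedral 6]; decide)

/-- A certificate for the presentation of `PGL(2, 9)`. -/
def pglTwoNineCertificate : CardCertificate where
  sub := triple [.x] [.y] [.z, .x, .z]
  subRelations := [([.x, .y], 2), ([.x, .z], 2), ([.y, .z], 5)]
  index := 36
  card := 20
  relationScans :=
    [(1, 3), (1, 4), (10, 6)]
  indexScans :=
    [(2, 3), (1, 5), (6, 3), (4, 4), (12, 3), (7, 4), (16, 3), (10, 5), (25, 3), (22, 3), (14, 4),
     (1, 6), (4, 6), (21, 4), (23, 4), (37, 3), (28, 5), (40, 3), (26, 5), (14, 6), (41, 5),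
     (32, 6), (35, 5), (42, 4), (30, 6)]
  cardScans :=
    [(1, 3), (4, 4), (6, 3), (8, 4), (10, 3), (1, 4), (14, 3), (12, 4), (2, 5), (18, 3), (1, 5)]

/-- In the subgroup `⟨x, y, zxz⟩` the element `x` is central, and `y · zxz` has order dividing 5
like `xzyz`. This bounds its order by that of `2 × D_{10}`. -/
theorem isQuotientOf_pglTwoNine
    (hg : Satisfies g (relations 5 [(xzyz, 5)]))
    (hgen : Subgroup.closure (Set.range g) = ⊤) : IsQuotientOf G PGLTwoNine :=
  isQuotientOf_of_check hg hgen satisfies_pglGens closure_pglGens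
    pglTwoNineCertificate (by decide +kernel) (by rw [card_pglTwoNine]; decide)

/-- A certificate for the presentation of `2 × (2 ^ 4 : S_5)`. -/
def twoPowFourSymmCertificate : CardCertificate where
  sub := triple [.x] [.y] [.z, .x, .z]
  subRelations := [([.x, .y], 2), ([.x, .z], 2), ([.y, .z], 6)]
  index := 160
  card := 24
  relationScans :=
    [(1, 3), (1, 4), (10, 6)]
  indexScans :=
    [(2, 3), (1, 5), (6, 3), (4, 4), (12, 3), (7, 4), (16, 3), (10, 5), (25, 3), (14, 4), (28, 3),
     (1, 6), (32, 3), (26, 5), (36, 3), (38, 3), (39, 4), (27, 4), (37, 4), (49, 3), (21, 4),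
     (55, 3), (20, 5), (4, 6), (12, 6), (60, 4), (76, 3), (56, 5), (1, 7), (58, 3), (69, 3),
     (22, 3), (65, 3), (80, 3), (47, 3), (81, 4), (78, 4), (94, 3), (59, 5), (97, 3), (77, 5),
     (103, 3), (96, 4), (60, 6), (90, 4), (113, 3), (110, 3), (41, 5), (14, 6), (120, 3), (28, 6),
     (124, 3), (87, 5), (99, 5), (111, 5), (136, 3), (116, 4), (56, 7), (100, 4), (137, 4),
     (148, 3), (17, 7), (139, 4), (150, 4), (156, 3), (137, 6), (141, 5), (113, 6), (157, 5),
     (90, 6), (30, 7), (175, 3), (76, 6), (104, 5), (82, 6), (26, 7), (179, 4), (180, 5), (37, 7),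
     (105, 4), (21, 6), (61, 7), (115, 6), (184, 3), (72, 5), (50, 5), (96, 6), (150, 6), (188, 3),
     (189, 4), (83, 7), (53, 4), (189, 6), (195, 5), (37, 6), (198, 3), (78, 7), (191, 5), (188, 6),
     (111, 7), (189, 7), (199, 6)]
  cardScans :=
    [(1, 4), (4, 3), (1, 3), (8, 4), (10, 3), (12, 4), (14, 3), (16, 4), (18, 3), (20, 4), (2, 5),
     (22, 3), (1, 5)]

/-- The same subgroup as for `PGL(2, 9)`, now bounded by `2 × D_{12}`. -/
theorem isQuotientOf_twoPowFourSymm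
    (hg : Satisfies g (relations 5 [(xzyz, 6), (xyzyxz, 6)]))
    (hgen : Subgroup.closure (Set.range g) = ⊤) : IsQuotientOf G (Cyc 2 × TwoPowFourSymm) :=
  isQuotientOf_of_check hg hgen satisfies_subsetGens closure_subsetGens
    twoPowFourSymmCertificate (by decide +kernel) (by rw [card_twoPowFourSymm]; decide)

/-- A certificate for the presentation of `2 × (2 ^ 6 : S_5)`. -/
def twoPowSixSymmCertificate : CardCertificate where
  sub := triple [.z] [.y, .z, .y] [.x, .y, .z, .y, .x]
  subRelations := [([.x, .y], 3), ([.x, .z], 5), ([.y, .z], 2)]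
  index := 128
  card := 120
  relationScans :=
    [(1, 3), (4, 4), (7, 3), (5, 3), (10, 3), (1, 5), (1, 8)]
  indexScans :=
    [(1, 3), (1, 4), (8, 3), (4, 5), (14, 3), (13, 4), (23, 3), (1, 6), (21, 3), (26, 3), (9, 5),
     (32, 3), (29, 4), (41, 3), (27, 5), (44, 3), (9, 9), (22, 8), (47, 3), (31, 4), (53, 3),
     (2, 7), (43, 4), (58, 3), (4, 8), (62, 4), (49, 5), (29, 6), (25, 6), (29, 7), (46, 9),
     (18, 5), (88, 3), (84, 3), (86, 3), (85, 4), (94, 3), (54, 8), (87, 4), (105, 3), (27, 8),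
     (105, 6), (25, 9), (27, 9), (2, 9), (51, 5), (90, 5), (42, 5), (22, 9), (13, 9), (59, 8),
     (110, 3), (63, 8), (57, 8), (46, 6), (43, 7), (59, 9), (62, 7), (111, 5), (143, 6), (38, 7),
     (85, 8), (85, 6), (90, 9), (23, 6), (26, 7), (85, 9), (23, 7), (31, 9), (13, 6), (13, 7),
     (167, 3), (87, 9), (119, 8), (166, 7), (8, 7), (122, 9), (166, 6), (62, 9)]
  cardScans :=
    [(1, 5), (1, 3), (7, 5), (5, 5), (9, 3), (13, 5), (16, 5), (12, 3), (23, 5), (21, 5), (6, 4),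
     (29, 5), (30, 3), (33, 5), (20, 3), (37, 5), (28, 3), (41, 5), (43, 5), (1, 4), (49, 5),
     (50, 3), (53, 5), (46, 3), (57, 5), (22, 4), (61, 5), (62, 3), (65, 5), (36, 3), (69, 5),
     (42, 4), (73, 5), (74, 3), (77, 5), (68, 3), (81, 5), (63, 4), (85, 5), (86, 3), (89, 5),
     (75, 4), (51, 4), (95, 5), (80, 3), (99, 5), (31, 4), (102, 3), (101, 5), (39, 3), (105, 5),
     (14, 4), (2, 4), (112, 3), (111, 5), (18, 3), (115, 5), (108, 3), (114, 4), (117, 5), (119, 3)]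

/-- The three conjugates `z`, `yzy`, `xyzyx` of `z` satisfy the relations of the Coxeter group
`H_3`, of order 120. -/
theorem isQuotientOf_twoPowSixSymm
    (hg : Satisfies g (relations 6 [(xzyz, 6), (xzyzyz, 6), (xyzyxz, 5), (xyzyzyxz, 4)]))
    (hgen : Subgroup.closure (Set.range g) = ⊤) : IsQuotientOf G (Cyc 2 × TwoPowSixSymm) :=
  isQuotientOf_of_check hg hgen satisfies_subgraphGens closure_subgraphGens
    twoPowSixSymmCertificate (by decide +kernel) (by rw [card_twoPowSixSymm]; decide)

/-- A certificate for the presentation of `3 ^ 4 : (D_8 × S_3)`. -/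
def threePowFourCertificate : CardCertificate where
  sub := triple [.x] [.y, .z, .x, .z, .y] [.y, .z, .y, .z, .y]
  subRelations := [([.x, .y], 2), ([.x, .z], 6), ([.y, .z], 2)]
  index := 162
  card := 24
  relationScans :=
    [(1, 3), (4, 4), (7, 3), (10, 3), (4, 6), (28, 3), (20, 3), (33, 3), (16, 3), (24, 3), (7, 7)]
  indexScans :=
    [(1, 4), (6, 3), (8, 3), (1, 5), (16, 3), (13, 4), (20, 3), (23, 3), (14, 4), (28, 3), (30, 3),
     (3, 6), (38, 3), (7, 5), (1, 7), (42, 3), (43, 4), (48, 3), (25, 4), (52, 3), (35, 4), (29, 5),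
     (57, 4), (68, 3), (25, 6), (68, 6), (21, 5), (88, 3), (86, 3), (87, 4), (93, 3), (20, 7),
     (25, 7), (74, 4), (97, 4), (119, 3), (121, 4), (122, 3), (128, 4), (135, 3), (13, 8), (56, 5),
     (94, 5), (69, 5), (18, 5), (3, 7), (160, 3), (161, 4), (168, 3), (120, 5), (43, 7), (178, 3),
     (179, 4), (186, 3), (46, 5), (192, 3), (13, 6), (48, 7), (193, 4), (194, 5), (188, 4),
     (123, 5), (90, 5), (57, 7), (52, 7), (136, 5), (166, 5), (254, 3), (113, 7), (36, 6), (27, 8),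
     (278, 4), (285, 3), (280, 4), (281, 5), (161, 6), (179, 6), (57, 6), (254, 7), (254, 6),
     (135, 7), (97, 7), (121, 6), (196, 6), (74, 7), (36, 7), (68, 7), (424, 5), (30, 7), (121, 7),
     (179, 7), (93, 7), (128, 7), (119, 7), (122, 7), (135, 6), (113, 6), (278, 7), (278, 6),
     (186, 7), (253, 6), (35, 8), (57, 8), (121, 8), (281, 8), (123, 8), (278, 8), (154, 8),
     (773, 2), (809, 7), (809, 3), (809, 9), (809, 5), (1, 8), (2, 7), (65, 8), (72, 8), (84, 8)]
  cardScans :=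
    [(1, 5), (4, 3), (1, 3), (7, 5), (10, 3), (11, 5), (14, 3), (15, 5), (18, 3), (19, 5), (2, 4),
     (22, 3), (1, 4)]

/-- The involution `yzxzy` commutes with `x` and with `yzyzy`, so the subgroup is bounded by `2 ×
D_{12}`. -/
theorem isQuotientOf_threePowFour
    (hg : Satisfies g (relations 6 [(xzyz, 6), (xzyzyz, 4), (xyzyxz, 6), (xyzyzyxzyz, 6)]))
    (hgen : Subgroup.closure (Set.range g) = ⊤) : IsQuotientOf G ThreePowFour :=
  isQuotientOf_of_check hg hgen satisfies_tensorGens closure_tensorGens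
    threePowFourCertificate (by decide +kernel) (by rw [card_threePowFour]; decide)

/-- A certificate for the presentation of `(S_4 × S_4) : 2 ^ 2`. -/
def symmFourSqCertificate : CardCertificate where
  sub := triple [.x, .z, .x] [.y, .z, .y] [.x, .y, .z, .y, .x]
  subRelations := [([.x, .y], 4), ([.x, .z], 3), ([.y, .z], 2)]
  index := 48
  card := 48
  relationScans :=
    [(1, 3), (4, 4), (7, 3), (10, 3), (5, 3), (2, 5), (2, 8), (24, 7), (41, 8), (23, 6)]
  indexScans :=
    [(1, 3), (1, 4), (8, 3), (1, 5), (12, 4), (20, 3), (4, 7), (1, 6), (18, 3), (22, 3), (15, 4),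
     (28, 3), (23, 5), (33, 4), (14, 8), (21, 5), (40, 3), (6, 8), (27, 4), (49, 3), (9, 5), (8, 7),
     (12, 7), (23, 8), (27, 6), (47, 7), (52, 4), (12, 6), (24, 7), (44, 5), (20, 7), (20, 6)]
  cardScans :=
    [(1, 5), (2, 4), (1, 4), (11, 5), (9, 5), (4, 3), (17, 5), (14, 4), (23, 5), (10, 3), (26, 5),
     (15, 4), (30, 5), (1, 3), (34, 5), (7, 5), (18, 4), (37, 5), (32, 4), (6, 3), (41, 5), (39, 4),
     (21, 3), (24, 4), (31, 3)]

/-- The three conjugates `xzx`, `yzy`, `xyzyx` of `z` satisfy the relations of the Coxeter group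
`B_3`, of order 48. -/
theorem isQuotientOf_symmFourSq
    (hg : Satisfies g (relations 6 [(xzyz, 6), (xzyzyz, 4), (xyzyxz, 4)]))
    (hgen : Subgroup.closure (Set.range g) = ⊤) : IsQuotientOf G SymmFourSq :=
  isQuotientOf_of_check hg hgen satisfies_symmSqGens closure_symmSqGens
    symmFourSqCertificate (by decide +kernel) (by rw [card_symmFourSq]; decide)

/-- A certificate for the presentation of `(A_5 × A_5) : 2 ^ 2`. -/
def altFiveSqCertificate : CardCertificate where
  sub := triple [.y] [.z, .x, .z] [.z, .y, .z]
  subRelations := [([.x, .y], 5), ([.x, .z], 3), ([.y, .z], 2)]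
  index := 120
  card := 120
  relationScans :=
    [(1, 5), (12, 3), (12, 6), (1, 8)]
  indexScans :=
    [(1, 3), (1, 4), (6, 3), (4, 5), (10, 3), (17, 4), (22, 3), (24, 4), (25, 3), (1, 8), (12, 3),
     (30, 3), (19, 3), (31, 4), (25, 6), (26, 5), (17, 6), (53, 3), (23, 5), (60, 3), (58, 3),
     (39, 4), (8, 6), (70, 3), (18, 5), (1, 7), (72, 4), (19, 7), (39, 6), (59, 4), (68, 6),
     (79, 3), (69, 5), (82, 4), (93, 3), (80, 5), (95, 4), (84, 4), (104, 3), (72, 6), (37, 4),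
     (33, 6), (24, 6), (8, 7), (16, 5), (125, 3), (126, 4), (127, 3), (129, 3), (22, 7), (93, 6),
     (63, 5), (31, 6), (24, 7), (72, 8), (22, 6), (66, 5), (16, 8), (121, 5), (6, 7), (141, 3),
     (140, 4), (128, 6), (140, 8), (25, 7), (98, 6), (32, 8), (59, 6), (39, 7), (106, 3), (80, 8),
     (105, 5), (153, 3), (82, 6), (126, 6), (31, 7), (11, 8), (138, 4), (122, 6), (68, 7), (95, 6),
     (116, 5), (141, 7), (139, 6), (102, 5), (52, 6), (129, 7), (99, 8), (21, 8), (139, 7)]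
  cardScans :=
    [(1, 5), (1, 4), (7, 5), (5, 5), (9, 4), (13, 5), (11, 4), (21, 5), (19, 5), (6, 3), (27, 5),
     (17, 4), (31, 5), (28, 4), (35, 5), (25, 4), (39, 5), (41, 5), (1, 3), (47, 5), (48, 4),
     (51, 5), (43, 4), (55, 5), (20, 3), (59, 5), (60, 4), (63, 5), (37, 4), (67, 5), (40, 3),
     (71, 5), (72, 4), (75, 5), (65, 4), (79, 5), (62, 3), (83, 5), (84, 4), (87, 5), (74, 3),
     (50, 3), (93, 5), (77, 4), (97, 5), (98, 4), (99, 5), (53, 4), (103, 5), (8, 3), (107, 5),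
     (105, 4), (104, 3), (109, 5), (112, 4), (14, 3), (113, 5), (115, 4), (30, 3), (117, 5),
     (119, 4)]

/-- The elements `y`, `zxz`, `zyz` satisfy the relations of the Coxeter group `H_3`, of order 120.
-/
theorem isQuotientOf_altFiveSq
    (hg : Satisfies g (relations 6 [(xzyz, 5), (xzyzyz, 6), (xyzyxz, 6)]))
    (hgen : Subgroup.closure (Set.range g) = ⊤) : IsQuotientOf G AltFiveSq :=
  isQuotientOf_of_check hg hgen satisfies_altSqGens closure_altSqGens
    altFiveSqCertificate (by decide +kernel) (by rw [card_altFiveSq]; decide)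

end

/-! ### Exponents that force the relations of `2 ^ r : D_{2r}` -/

theorem implies_five_xzyz_six_xyzyxz_four :
    implies (relations 5 [(xzyz, 6), (xyzyxz, 4)]) [(xzyz, 4)]
      [(1, 3), (3, 4), (5, 3), (12, 4), (16, 3), (13, 3), (11, 5), (1, 5), (20, 4), (38, 3),
       (14, 5), (41, 3), (42, 4), (48, 3), (2, 5), (56, 3), (61, 3), (2, 7), (66, 3), (4, 7),
       (67, 4), (76, 3), (49, 5), (79, 4), (87, 3), (68, 5), (83, 7), (97, 3), (102, 3), (96, 4),
       (105, 5), (113, 3), (3, 6), (60, 6), (117, 5), (62, 7), (25, 4), (15, 7)] = true := by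
  decide +kernel

theorem implies_five_xzyz_six_xyzyxz_five :
    implies (relations 5 [(xzyz, 6), (xyzyxz, 5)]) [(xzyz, 4)]
      [(1, 3), (3, 4), (10, 3), (5, 3), (14, 4), (20, 3), (18, 3), (1, 5), (25, 3), (28, 3), (2, 5),
       (38, 3), (36, 3), (11, 5), (49, 3), (51, 4), (56, 3), (58, 4), (59, 3), (50, 5), (69, 3),
       (57, 5), (41, 5), (84, 3), (72, 5), (94, 3), (49, 6), (101, 5), (1, 6), (112, 3), (113, 4),
       (109, 4), (12, 6), (22, 7), (137, 3), (144, 5), (141, 4), (138, 5), (58, 6), (3, 7), (1, 7),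
       (53, 3), (78, 3), (135, 3), (47, 3), (164, 3), (133, 3), (160, 3), (75, 3), (126, 4),
       (129, 3), (168, 3), (162, 3), (127, 3), (166, 3), (161, 4), (130, 4), (165, 4), (134, 4),
       (169, 4), (223, 3), (52, 5), (163, 5), (210, 4), (202, 5), (217, 7), (242, 4), (105, 6),
       (10, 6), (274, 3), (276, 4), (277, 3), (280, 4), (281, 3), (283, 3), (284, 4), (287, 3),
       (290, 4), (44, 3), (288, 7), (282, 5), (278, 5), (37, 7), (134, 6)] = true := by
  decide +kernel

/-- For `r = 6` every branch without a group of its own collapses to the relations `(xzyz)⁴ =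
(xzyzyz)⁴ = 1`. The group may collapse further, which does not matter for being a quotient. -/
theorem implies_six_xzyz_four_xzyzyz_five :
    implies (relations 6 [(xzyz, 4), (xzyzyz, 5)]) [(xzyz, 4), (xzyzyz, 4)]
      -- The pair `(2, 2)` scans `zz` at coset 2, whose only effect is to define the image of that
      -- coset under `z`.
      [(1, 3), (2, 2), (5, 3), (5, 6), (15, 3), (11, 3), (10, 4), (24, 4), (32, 3), (34, 3),
       (16, 5), (24, 6), (17, 6), (18, 6), (15, 7), (36, 6), (92, 3), (99, 4), (100, 3), (5, 7),
       (72, 3), (64, 3), (60, 3), (108, 4), (112, 3), (60, 7), (67, 6), (64, 7), (116, 6), (150, 3),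
       (157, 4), (158, 3), (1, 7), (32, 7), (4, 7)] = true := by
  decide +kernel

theorem implies_six_xzyz_four_xzyzyz_six_xyzyxz_four :
    implies (relations 6 [(xzyz, 4), (xzyzyz, 6), (xyzyxz, 4)]) [(xzyz, 4), (xzyzyz, 4)]
      [(1, 3), (1, 4), (2, 5), (18, 3), (11, 3), (16, 3), (17, 4), (29, 3), (12, 4), (35, 3),
       (32, 3), (39, 4), (46, 3), (12, 6), (38, 4), (33, 5), (4, 6), (67, 3), (1, 5), (72, 3),
       (75, 4), (1, 6), (3, 8), (96, 3), (93, 3), (1, 8), (94, 4), (48, 6), (8, 5), (115, 3),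
       (114, 4), (90, 6), (97, 5), (80, 6), (96, 6), (6, 8), (71, 8), (31, 6), (174, 3), (182, 4),
       (186, 3), (87, 7), (1, 7), (190, 6), (29, 7), (39, 7)] = true := by
  decide +kernel

theorem implies_six_xzyz_four_xzyzyz_six_xyzyxz_five :
    implies (relations 6 [(xzyz, 4), (xzyzyz, 6), (xyzyxz, 5)]) [(xzyz, 4), (xzyzyz, 4)]
      [(1, 3), (4, 4), (10, 3), (5, 3), (12, 4), (14, 4), (26, 3), (21, 6), (30, 3), (4, 6), (1, 4),
       (39, 3), (44, 3), (41, 3), (2, 5), (52, 3), (54, 3), (53, 4), (62, 3), (46, 4), (65, 3),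
       (69, 4), (76, 3), (68, 6), (40, 5), (84, 3), (86, 3), (77, 5), (97, 3), (41, 6), (97, 6),
       (87, 5), (49, 6), (126, 3), (133, 4), (2, 8), (71, 3), (82, 4), (116, 3), (117, 4), (85, 6),
       (44, 7), (38, 3), (37, 4), (165, 3), (162, 4), (166, 6), (180, 3), (179, 5), (183, 3),
       (181, 4), (28, 8), (194, 3), (197, 3), (184, 4), (96, 8), (198, 5), (73, 7), (196, 6),
       (1, 7), (244, 4), (244, 8)] = true := by
  decide +kernel

theorem implies_six_xzyz_four_xzyzyz_six_xyzyxz_six :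
    implies (relations 6 [(xzyz, 4), (xzyzyz, 6), (xyzyxz, 6)]) [(xzyz, 4), (xzyzyz, 4)]
      [(1, 3), (4, 4), (10, 3), (5, 3), (14, 4), (20, 3), (22, 4), (2, 5), (31, 3), (33, 3),
       (32, 4), (41, 3), (30, 4), (47, 3), (50, 4), (41, 6), (32, 6), (15, 6), (71, 3), (70, 5),
       (74, 3), (16, 5), (84, 3), (84, 6), (48, 5), (50, 6), (4, 8), (132, 3), (129, 3), (126, 3),
       (123, 3), (120, 3), (117, 3), (2, 8), (59, 4), (118, 4), (141, 3), (58, 5), (147, 3),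
       (149, 6), (159, 3), (150, 3), (158, 4), (164, 3), (163, 4), (171, 3), (173, 4), (174, 3),
       (162, 5), (172, 5), (129, 6), (54, 8), (208, 3), (211, 3), (214, 3), (221, 4), (222, 5),
       (208, 6), (34, 8), (257, 3), (254, 3), (251, 3), (248, 3), (245, 3), (30, 8), (101, 3),
       (95, 4), (102, 4), (246, 6), (261, 5), (211, 7), (257, 6), (33, 7), (66, 3)] = true := by
  decide +kernel

theorem implies_six_xzyz_five_xzyzyz_four :
    implies (relations 6 [(xzyz, 5), (xzyzyz, 4)]) [(xzyz, 4), (xzyzyz, 4)]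
      [(1, 3), (1, 4), (5, 3), (10, 3), (1, 5), (19, 3), (6, 5), (8, 5), (20, 6), (10, 7), (57, 3),
       (58, 4), (4, 6), (81, 3), (73, 3), (79, 3), (83, 4), (89, 3), (93, 4), (77, 7), (93, 6),
       (4, 7), (8, 7), (12, 6), (97, 3), (111, 4), (15, 6), (117, 3), (84, 5), (117, 7), (114, 6)] = true := by
  decide +kernel

theorem implies_six_xzyz_five_xzyzyz_five :
    implies (relations 6 [(xzyz, 5), (xzyzyz, 5)]) [(xzyz, 4), (xzyzyz, 4)]
      [(1, 3), (3, 4), (10, 3), (7, 3), (5, 3), (6, 5), (19, 3), (20, 4), (30, 3), (33, 4), (1, 5),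
       (40, 3), (2, 5), (53, 3), (55, 3), (54, 4), (62, 3), (65, 3), (63, 5), (75, 3), (25, 5),
       (65, 6), (12, 6), (7, 7), (69, 6), (130, 3), (138, 4), (142, 3), (1, 7), (43, 6), (152, 7),
       (16, 7), (179, 3), (175, 3), (176, 4), (33, 6), (41, 6), (201, 3), (210, 4), (214, 3),
       (205, 7), (218, 6), (228, 3), (41, 7), (239, 3), (236, 4), (65, 7), (251, 3), (248, 4),
       (247, 3), (240, 6), (252, 3), (55, 7), (31, 3)] = true := by
  decide +kernel

theorem implies_six_xzyz_five_xzyzyz_six_xyzyxz_four :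
    implies (relations 6 [(xzyz, 5), (xzyzyz, 6), (xyzyxz, 4)]) [(xzyz, 4), (xzyzyz, 4)]
      [(1, 3), (4, 4), (10, 3), (1, 4), (15, 3), (13, 3), (1, 5), (29, 3), (23, 3), (27, 3),
       (14, 5), (40, 3), (43, 5), (54, 3), (52, 3), (50, 3), (59, 5), (53, 6), (10, 6), (19, 6),
       (4, 6), (2, 8), (4, 8), (24, 6), (28, 8), (51, 8), (22, 8), (196, 3), (193, 3), (198, 5),
       (199, 4), (212, 3), (14, 8), (215, 4), (210, 5), (191, 6), (236, 3), (238, 3), (232, 3),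
       (233, 4), (197, 6), (22, 7), (270, 3), (266, 3), (267, 4), (237, 6), (251, 7), (23, 7),
       (98, 4), (97, 3), (96, 4), (74, 3), (66, 7), (42, 3), (12, 7), (159, 3), (162, 3), (164, 4),
       (161, 5), (160, 4), (355, 3), (163, 5), (163, 8), (365, 4), (143, 3), (359, 6), (369, 4),
       (150, 7)] = true := by
  decide +kernel

theorem implies_six_xzyz_five_xzyzyz_six_xyzyxz_five :
    implies (relations 6 [(xzyz, 5), (xzyzyz, 6), (xyzyxz, 5)]) [(xzyz, 4), (xzyzyz, 4)]
      [(1, 3), (1, 4), (7, 3), (5, 3), (10, 3), (14, 4), (22, 3), (20, 3), (26, 4), (32, 3),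
       (30, 3), (34, 4), (42, 3), (21, 5), (24, 4), (53, 3), (2, 5), (58, 3), (56, 3), (59, 4),
       (67, 3), (57, 4), (70, 3), (74, 4), (81, 3), (36, 4), (1, 6), (7, 6), (1, 5), (92, 4),
       (102, 3), (100, 3), (99, 4), (81, 6), (117, 3), (118, 5), (126, 3), (82, 5), (135, 3),
       (3, 8), (147, 3), (144, 3), (141, 3), (1, 8), (112, 3), (28, 3), (142, 4), (139, 5),
       (158, 3), (84, 5), (167, 3), (24, 8), (178, 3), (175, 3), (21, 8), (173, 4), (181, 4),
       (30, 6), (162, 5), (153, 6), (210, 3), (218, 4), (222, 3), (128, 6), (34, 6), (26, 7),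
       (226, 6), (101, 8), (84, 8), (4, 7), (284, 3), (287, 3), (288, 4), (286, 6), (14, 8),
       (306, 3), (303, 3), (300, 3), (297, 3), (294, 3), (292, 4), (304, 4), (298, 4), (356, 6),
       (298, 7), (204, 7), (300, 6), (281, 5), (110, 5), (184, 5), (39, 8), (357, 5), (157, 7),
       (26, 8), (241, 3)] = true := by
  decide +kernel

theorem implies_six_xzyz_six_xzyzyz_four_xyzyxz_five :
    implies (relations 6 [(xzyz, 6), (xzyzyz, 4), (xyzyxz, 5)]) [(xzyz, 4), (xzyzyz, 4)]
      [(1, 3), (2, 5), (5, 3), (14, 3), (10, 3), (12, 3), (11, 4), (26, 3), (28, 4), (16, 5),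
       (44, 3), (37, 3), (46, 4), (53, 3), (38, 4), (45, 5), (65, 4), (54, 5), (83, 3), (85, 4),
       (90, 3), (91, 5), (101, 3), (47, 5), (110, 3), (44, 7), (117, 4), (111, 4), (126, 3),
       (46, 7), (130, 3), (113, 5), (5, 6), (55, 6), (5, 7), (168, 3), (166, 3), (162, 4), (167, 4),
       (60, 5), (171, 5), (166, 7), (3, 8), (210, 3), (207, 3), (205, 4), (1, 5), (102, 5), (1, 7),
       (87, 3), (50, 3), (223, 3), (78, 3), (237, 3), (94, 3), (151, 4), (154, 3), (76, 3),
       (238, 4), (155, 4), (240, 4), (258, 3), (236, 4), (211, 6), (246, 5), (103, 7), (282, 3),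
       (113, 8), (6, 6), (277, 4), (262, 8), (289, 4), (292, 3), (294, 3), (293, 5), (296, 4),
       (55, 7), (11, 8), (306, 3), (82, 7), (91, 8), (7, 8), (91, 4), (6, 7), (65, 6), (82, 6),
       (319, 3), (318, 5), (317, 7), (320, 4), (321, 3), (308, 7), (61, 6), (94, 7), (222, 8),
       (2, 8)] = true := by
  decide +kernel

theorem implies_six_xzyz_six_xzyzyz_four_xyzyxz_six_xyzyzyxzyz_four :
    implies (relations 6 [(xzyz, 6), (xzyzyz, 4), (xyzyxz, 6), (xyzyzyxzyz, 4)]) [(xzyz, 4), (xzyzyz, 4)]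
      [(1, 3), (4, 4), (10, 3), (1, 4), (18, 3), (15, 3), (1, 5), (23, 3), (16, 5), (14, 5),
       (24, 7), (57, 3), (55, 3), (50, 3), (64, 4), (66, 3), (21, 7), (13, 6), (92, 3), (7, 7),
       (13, 9), (2, 8), (72, 3), (120, 3), (130, 3), (134, 4), (124, 4), (132, 5), (130, 7), (4, 9),
       (191, 3), (213, 3), (208, 3), (209, 4), (2, 9), (195, 3), (196, 4), (233, 3), (229, 5),
       (234, 5), (235, 7), (208, 7), (1, 8), (36, 3), (35, 4), (79, 3), (77, 3), (313, 4), (314, 3),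
       (78, 8), (315, 4), (316, 3), (264, 3), (229, 9), (195, 5), (195, 9)] = true := by
  decide +kernel

theorem implies_six_xzyz_six_xzyzyz_four_xyzyxz_six_xyzyzyxzyz_five :
    implies (relations 6 [(xzyz, 6), (xzyzyz, 4), (xyzyxz, 6), (xyzyzyxzyz, 5)]) [(xzyz, 4), (xzyzyz, 4)]
      [(1, 3), (4, 4), (5, 3), (10, 3), (7, 3), (1, 4), (19, 3), (17, 3), (22, 3), (26, 4), (1, 5),
       (18, 5), (11, 5), (55, 3), (20, 5), (13, 5), (23, 7), (36, 7), (94, 3), (96, 3), (89, 3),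
       (103, 4), (105, 3), (19, 7), (22, 6), (15, 7), (1, 7), (1, 8), (63, 3), (85, 5), (164, 3),
       (158, 3), (167, 3), (170, 3), (161, 3), (62, 4), (84, 3), (117, 3), (82, 3), (190, 4),
       (193, 3), (3, 8), (190, 7), (83, 8), (218, 3), (222, 4), (22, 9), (259, 3), (249, 3),
       (254, 3), (251, 5), (2, 8), (290, 4), (42, 3), (74, 5), (77, 3), (235, 3), (232, 3), (75, 3),
       (294, 4), (231, 4), (17, 9), (319, 3), (318, 4), (317, 3), (309, 3), (314, 3), (316, 4),
       (311, 5), (309, 7), (329, 3)] = true := by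
  decide +kernel

theorem implies_six_xzyz_six_xzyzyz_five :
    implies (relations 6 [(xzyz, 6), (xzyzyz, 5)]) [(xzyz, 4), (xzyzyz, 4)]
      [(1, 4), (7, 3), (3, 3), (12, 4), (13, 3), (18, 3), (16, 3), (20, 4), (22, 4), (34, 3),
       (38, 4), (44, 3), (39, 3), (48, 4), (52, 3), (56, 4), (46, 4), (66, 3), (70, 4), (76, 3),
       (38, 6), (78, 4), (86, 3), (90, 4), (96, 3), (1, 7), (101, 3), (98, 4), (102, 4), (110, 3),
       (112, 4), (116, 3), (24, 4), (124, 3), (90, 6), (135, 3), (137, 4), (141, 3), (80, 7),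
       (5, 6), (5, 7), (164, 3), (60, 6), (12, 6), (42, 6), (122, 7), (128, 6), (126, 7), (56, 6),
       (153, 7)] = true := by
  decide +kernel

theorem implies_six_xzyz_six_xzyzyz_six_xyzyxz_four :
    implies (relations 6 [(xzyz, 6), (xzyzyz, 6), (xyzyxz, 4)]) [(xzyz, 4), (xzyzyz, 4)]
      [(1, 3), (1, 4), (10, 3), (5, 3), (7, 3), (14, 4), (20, 3), (22, 3), (24, 4), (30, 3),
       (32, 3), (34, 4), (40, 3), (42, 3), (36, 4), (52, 3), (21, 5), (26, 4), (61, 3), (2, 5),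
       (66, 3), (67, 4), (73, 3), (31, 5), (84, 3), (78, 4), (92, 3), (44, 4), (7, 6), (15, 4),
       (8, 5), (41, 5), (74, 5), (72, 5), (1, 8), (140, 3), (137, 3), (3, 8), (87, 3), (141, 4),
       (148, 3), (139, 4), (142, 5), (156, 3), (136, 4), (164, 3), (167, 4), (171, 3), (173, 3),
       (175, 4), (181, 3), (183, 3), (137, 6), (138, 5), (151, 4), (199, 3), (177, 4), (205, 3),
       (172, 5), (67, 7), (51, 5), (62, 8), (95, 8), (5, 6), (256, 3), (248, 3), (252, 3), (253, 5),
       (141, 8), (22, 7), (108, 8), (24, 8), (246, 3), (243, 3), (240, 3), (238, 4), (82, 4),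
       (321, 4), (244, 4), (320, 5), (321, 6), (78, 7), (357, 3), (347, 3), (354, 4), (348, 4),
       (244, 6), (30, 6), (49, 8), (340, 3), (397, 4), (32, 7), (209, 8), (185, 6), (203, 7)] = true := by
  decide +kernel

theorem implies_six_xzyz_six_xzyzyz_six_xyzyxz_five_xyzyzyxz_five :
    implies (relations 6 [(xzyz, 6), (xzyzyz, 6), (xyzyxz, 5), (xyzyzyxz, 5)]) [(xzyz, 4), (xzyzyz, 4)]
      [(1, 3), (1, 4), (5, 3), (12, 4), (16, 3), (18, 3), (22, 4), (23, 3), (26, 3), (29, 4),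
       (38, 3), (17, 5), (20, 4), (32, 4), (24, 5), (40, 4), (6, 5), (1, 5), (81, 3), (75, 3),
       (77, 3), (79, 3), (76, 4), (92, 3), (78, 4), (98, 3), (96, 4), (109, 3), (110, 5), (120, 3),
       (99, 5), (126, 4), (109, 6), (1, 6), (149, 3), (150, 4), (146, 4), (50, 5), (134, 5),
       (174, 3), (173, 4), (175, 4), (188, 3), (193, 4), (200, 3), (2, 9), (206, 3), (203, 3),
       (189, 5), (8, 9), (137, 3), (215, 3), (213, 3), (180, 3), (129, 3), (211, 3), (178, 3),
       (182, 5), (12, 6), (2, 8), (246, 3), (243, 3), (240, 3), (4, 8), (247, 4), (198, 3), (20, 8),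
       (260, 4), (257, 5), (175, 6), (7, 6), (179, 8), (6, 8), (317, 4), (321, 3), (132, 8),
       (148, 9), (4, 9), (106, 3), (381, 4), (382, 3), (385, 4), (193, 7), (69, 8), (7, 7), (1, 8),
       (212, 8), (49, 7), (274, 3), (344, 4), (325, 9), (546, 3), (547, 4), (1, 9), (232, 3)] = true := by
  decide +kernel

theorem implies_six_xzyz_six_xzyzyz_six_xyzyxz_five_xyzyzyxz_six :
    implies (relations 6 [(xzyz, 6), (xzyzyz, 6), (xyzyxz, 5), (xyzyzyxz, 6)]) [(xzyz, 4), (xzyzyz, 4)]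
      [(1, 3), (1, 4), (7, 3), (10, 3), (5, 3), (16, 4), (20, 3), (22, 3), (24, 4), (32, 3),
       (26, 4), (35, 3), (21, 5), (2, 5), (4, 4), (56, 3), (53, 3), (11, 4), (64, 3), (68, 4),
       (72, 3), (74, 3), (6, 5), (1, 5), (89, 3), (85, 3), (90, 4), (86, 4), (8, 5), (104, 4),
       (5, 6), (120, 3), (10, 6), (126, 3), (128, 3), (124, 3), (57, 5), (136, 3), (141, 3),
       (65, 5), (117, 5), (159, 3), (158, 4), (162, 3), (7, 6), (1, 6), (180, 3), (182, 3),
       (177, 4), (183, 5), (31, 5), (36, 5), (205, 3), (208, 4), (217, 3), (222, 4), (218, 5),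
       (232, 4), (163, 5), (244, 3), (94, 8), (259, 4), (265, 3), (100, 5), (267, 4), (240, 5),
       (281, 3), (282, 4), (280, 4), (39, 9), (4, 9), (300, 3), (313, 4), (318, 3), (320, 4),
       (324, 3), (142, 5), (329, 3), (328, 4), (340, 3), (342, 4), (346, 3), (58, 7), (352, 4),
       (350, 4), (334, 5), (363, 3), (368, 5), (56, 7), (355, 5), (378, 4), (385, 3), (390, 4),
       (386, 5), (400, 4), (408, 5), (415, 3), (115, 9), (274, 5), (435, 4), (273, 6), (443, 5),
       (6, 8), (471, 3), (465, 3), (468, 3), (16, 8), (472, 5), (2, 9), (481, 3), (486, 3),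
       (489, 3), (484, 3), (483, 4), (8, 9), (464, 3), (446, 3), (438, 3), (462, 3), (459, 6),
       (290, 6), (378, 6), (181, 8), (463, 8), (406, 8), (4, 8), (612, 3), (609, 3), (606, 3),
       (603, 3), (600, 3), (2, 8), (498, 3), (485, 8), (621, 4), (516, 5), (41, 7), (22, 7), (1, 8),
       (218, 8), (30, 7), (521, 3), (734, 4), (579, 4), (735, 3), (179, 9), (303, 3), (117, 8),
       (32, 9)] = true := by
  decide +kernel

theorem implies_six_xzyz_six_xzyzyz_six_xyzyxz_six_xyzyzyxz_four :
    implies (relations 6 [(xzyz, 6), (xzyzyz, 6), (xyzyxz, 6), (xyzyzyxz, 4)]) [(xzyz, 4), (xzyzyz, 4)]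
      [(1, 3), (3, 4), (10, 3), (1, 4), (13, 3), (2, 5), (24, 3), (26, 3), (21, 3), (25, 4),
       (36, 3), (38, 4), (44, 3), (46, 4), (52, 3), (27, 5), (1, 5), (63, 4), (51, 5), (78, 3),
       (11, 5), (87, 3), (92, 3), (96, 4), (101, 3), (1, 7), (112, 3), (110, 3), (111, 4), (82, 5),
       (3, 7), (74, 3), (76, 3), (56, 3), (120, 4), (73, 4), (75, 4), (57, 4), (70, 5), (156, 4),
       (68, 9), (162, 5), (3, 9), (178, 3), (171, 3), (179, 4), (184, 3), (186, 4), (190, 3),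
       (93, 5), (195, 3), (200, 5), (201, 3), (204, 3), (202, 4), (205, 4), (211, 5), (223, 3),
       (12, 7), (235, 3), (233, 3), (224, 4), (234, 4), (10, 7), (227, 4), (176, 6), (25, 9),
       (271, 3), (276, 3), (268, 3), (274, 3), (266, 3), (270, 5), (20, 6), (227, 6), (50, 6),
       (222, 6), (339, 3), (341, 3), (340, 4), (346, 4), (36, 7), (365, 3), (363, 3), (360, 4),
       (366, 4), (46, 6), (46, 9), (20, 9), (109, 9), (181, 8), (38, 9), (385, 3), (389, 3),
       (391, 3), (386, 4), (390, 4), (388, 5), (392, 5), (2, 9), (139, 5), (50, 7), (386, 6),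
       (267, 8), (1, 8), (17, 8), (317, 3), (428, 3), (316, 4), (315, 5), (234, 8), (541, 3),
       (540, 4), (539, 3), (531, 3), (538, 9), (532, 5), (309, 4), (310, 3), (37, 5), (342, 9),
       (222, 9), (386, 8), (194, 9), (176, 8), (37, 8)] = true := by
  decide +kernel

theorem implies_six_xzyz_six_xzyzyz_six_xyzyxz_six_xyzyzyxz_five :
    implies (relations 6 [(xzyz, 6), (xzyzyz, 6), (xyzyxz, 6), (xyzyzyxz, 5)]) [(xzyz, 4), (xzyzyz, 4)]
      [(1, 3), (2, 5), (7, 3), (14, 3), (10, 3), (8, 4), (11, 4), (29, 3), (19, 5), (38, 3),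
       (36, 3), (37, 4), (46, 3), (41, 5), (54, 3), (16, 5), (61, 3), (1, 5), (74, 3), (72, 3),
       (73, 4), (84, 3), (83, 5), (4, 6), (104, 3), (100, 3), (93, 4), (111, 3), (108, 3), (101, 5),
       (68, 5), (109, 5), (130, 4), (4, 7), (57, 5), (150, 3), (152, 3), (1, 7), (158, 3), (22, 5),
       (167, 3), (168, 4), (176, 3), (175, 5), (137, 5), (194, 3), (195, 4), (203, 3), (151, 9),
       (73, 9), (215, 3), (202, 5), (217, 5), (48, 6), (13, 6), (29, 6), (38, 7), (114, 6), (41, 9),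
       (140, 3), (316, 3), (207, 3), (200, 3), (321, 3), (313, 3), (198, 3), (132, 4), (314, 4),
       (309, 5), (197, 6), (1, 9), (14, 7), (308, 4), (121, 3), (314, 7), (404, 3), (8, 9), (84, 7),
       (2, 9), (256, 3), (257, 5), (199, 8), (31, 8), (516, 5), (315, 8), (217, 8), (316, 7),
       (31, 9), (466, 3), (466, 7), (410, 3), (614, 3), (413, 3), (230, 3), (635, 5), (638, 3),
       (466, 6), (26, 3), (270, 3), (572, 3), (265, 3), (26, 5), (266, 5), (571, 5), (573, 5),
       (470, 5), (7, 9), (684, 3), (685, 5), (29, 9), (31, 7), (536, 4), (574, 3), (537, 3),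
       (540, 3), (543, 3), (546, 3), (724, 4), (549, 3), (498, 7), (498, 6), (469, 7)] = true := by
  decide +kernel

theorem implies_six_xzyz_six_xzyzyz_six_xyzyxz_six_xyzyzyxz_six :
    implies (relations 6 [(xzyz, 6), (xzyzyz, 6), (xyzyxz, 6), (xyzyzyxz, 6)]) [(xzyz, 4), (xzyzyz, 4)]
      [(1, 3), (4, 4), (10, 3), (5, 3), (12, 4), (20, 3), (1, 5), (27, 3), (21, 5), (4, 6), (52, 3),
       (34, 3), (40, 3), (46, 3), (48, 3), (44, 3), (33, 4), (49, 5), (56, 5), (78, 3), (80, 4),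
       (85, 3), (45, 5), (54, 5), (22, 6), (80, 6), (135, 3), (137, 4), (138, 3), (136, 5),
       (139, 5), (156, 3), (153, 3), (154, 4), (164, 3), (163, 5), (165, 5), (183, 3), (181, 4),
       (187, 5), (198, 3), (160, 5), (213, 3), (209, 3), (211, 3), (210, 4), (223, 3), (216, 5),
       (231, 3), (203, 5), (241, 3), (191, 5), (252, 4), (1, 9), (22, 7), (168, 7), (164, 7),
       (290, 3), (291, 4), (144, 6), (144, 7), (80, 7), (338, 3), (330, 3), (332, 3), (336, 3),
       (331, 6), (225, 6), (223, 6), (12, 7), (12, 8), (432, 5), (165, 9), (137, 8), (290, 7),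
       (291, 8), (291, 7), (12, 9), (276, 3), (268, 3), (110, 3), (111, 5), (269, 6), (87, 9),
       (14, 9), (311, 3), (471, 3), (194, 3), (239, 3), (463, 3), (480, 3), (477, 3), (286, 3),
       (468, 3), (460, 3), (147, 3), (173, 4), (278, 3), (321, 3), (313, 3), (307, 3), (466, 3),
       (146, 4), (743, 3), (478, 4), (236, 4), (467, 4), (465, 4), (195, 4), (732, 5), (768, 3),
       (769, 4), (731, 5), (775, 3), (739, 4), (470, 5), (308, 5), (459, 4), (285, 4), (773, 5),
       (805, 3), (806, 4), (462, 5), (475, 5), (481, 5), (479, 5), (736, 5), (841, 3), (842, 4),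
       (849, 3), (778, 5), (862, 3), (861, 4), (871, 9), (745, 7), (465, 6), (361, 3), (850, 5),
       (875, 3), (873, 4), (884, 3), (772, 7), (733, 6), (880, 5), (805, 7), (173, 9), (327, 9),
       (15, 5), (894, 3), (632, 3), (542, 4), (901, 3), (82, 5), (908, 4), (895, 5), (912, 3),
       (916, 3), (917, 5), (920, 3), (922, 3), (911, 5), (932, 4), (77, 9), (939, 3), (16, 8),
       (4, 9), (410, 3), (637, 3), (973, 3), (970, 3), (407, 4), (961, 4), (980, 3), (964, 5),
       (982, 4), (988, 3), (981, 5), (42, 9), (1004, 3), (989, 5), (970, 7), (963, 6), (921, 9),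
       (1044, 7)] = true := by
  decide +kernel

/-! ### The case distinction -/

/-- The order of `a` divides `4`, `5` or `6`. -/
def PowEqOne {G : Type*} [Group G] (a : G) : Prop := a ^ 4 = 1 ∨ a ^ 5 = 1 ∨ a ^ 6 = 1

theorem powEqOne_of_orderOf_le {G : Type*} [Group G] {a : G} (hf : IsOfFinOrder a)
    (ha : orderOf a ≤ 6) : PowEqOne a := by
  -- Since `orderOf` is `0` on elements of infinite order, the bound by 6 alone would not exclude
  -- these. Each of `1, …, 6` divides 4, 5 or 6.
  have hpos : 0 < orderOf a := hf.orderOf_pos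
  simp only [PowEqOne, ← orderOf_dvd_iff_pow_eq_one]
  generalize orderOf a = n at *
  revert n
  decide

section

variable {G : Type*} [Group G] {g : Gen → G}

theorem wordProd_reverse (hg : ∀ s, g s * g s = 1) (w : List Gen) :
    wordProd g w.reverse = (wordProd g w)⁻¹ := by
  rw [wordProd, wordProd, List.prod_inv_reverse, List.map_map, List.map_reverse]
  congr 3
  funext s
  exact (inv_eq_of_mul_eq_one_left (hg s)).symm

theorem IsSixTranspositionSet.wordProd_conj_mem {D : Set G} (hD : IsSixTranspositionSet D)
    (hgD : ∀ s, g s ∈ D) (hg : ∀ s, g s * g s = 1) (u : List Gen) (s : Gen) :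
    wordProd g (u ++ [s] ++ u.reverse) ∈ D := by
  rw [wordProd_append, wordProd_append, wordProd_reverse hg]
  simpa [wordProd] using hD.conj_mem (wordProd g u) (g s) (hgD s)

/-- For words in involutions, reversal is inversion, so `u s u.reverse` is a conjugate of a
generator and lies in `D`. -/
theorem IsSixTranspositionSet.powEqOne {D : Set G} (hD : IsSixTranspositionSet D)
    (hgD : ∀ s, g s ∈ D) (hg : ∀ s, g s * g s = 1) (u v : List Gen) (s t : Gen) :
    PowEqOne (wordProd g ((u ++ [s] ++ u.reverse) ++ (v ++ [t] ++ v.reverse))) := by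
  rw [wordProd_append]
  have hu := hD.wordProd_conj_mem hgD hg u s
  have hv := hD.wordProd_conj_mem hgD hg v t
  exact powEqOne_of_orderOf_le (hD.isOfFinOrder_mul _ hu _ hv) (hD.orderOf_mul_le _ hu _ hv)

theorem Satisfies.relations_snoc {r : ℕ} {R : Relations} (h : Satisfies g (relations r R))
    {w : List Gen} {n : ℕ} (hw : wordProd g w ^ n = 1) :
    Satisfies g (relations r (R ++ [(w, n)])) := by
  refine ⟨h.mul_self, fun p hp => ?_⟩
  rw [show relations r (R ++ [(w, n)]) = relations r R ++ [(w, n)] from rfl, List.mem_append,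
    List.mem_singleton] at hp
  rcases hp with hp | rfl
  exacts [h.pow_eq_one p hp, hw]

theorem Satisfies.relations_of_implies {r : ℕ} {R S : Relations}
    (h : Satisfies g (relations r R)) (l : List (ℕ × ℕ))
    (hl : implies (relations r R) S l = true) : Satisfies g (relations r S) := by
  refine ⟨h.mul_self, fun p hp => ?_⟩
  simp only [relations, List.mem_cons] at hp
  rcases hp with hp | hp | hp | hp
  · exact h.pow_eq_one p (by simp [relations, hp])
  · exact h.pow_eq_one p (by simp [relations, hp])
  · exact h.pow_eq_one p (by simp [relations, hp])
  · exact (h.of_implies l hl).pow_eq_one p hp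

theorem isQuotientOf_of_relations_five (h : Satisfies g (relations 5 []))
    (hgen : Subgroup.closure (Set.range g) = ⊤) (hA : PowEqOne (wordProd g xzyz))
    (hB : PowEqOne (wordProd g xyzyxz)) :
    IsQuotientOf G (TwoPowDihedral 5) ∨ IsQuotientOf G (Cyc 2 × TwoPowFourSymm) ∨
      IsQuotientOf G PGLTwoNine := by
  rcases hA with hA | hA | hA
  · exact .inl (isQuotientOf_twoPowDihedralFive (h.relations_snoc hA) hgen)
  · exact .inr (.inr (isQuotientOf_pglTwoNine (h.relations_snoc hA) hgen))
  replace h := h.relations_snoc hA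
  rcases hB with hB | hB | hB
  · exact .inl (isQuotientOf_twoPowDihedralFive ((h.relations_snoc hB).relations_of_implies _
      implies_five_xzyz_six_xyzyxz_four) hgen)
  · exact .inl (isQuotientOf_twoPowDihedralFive ((h.relations_snoc hB).relations_of_implies _
      implies_five_xzyz_six_xyzyxz_five) hgen)
  · exact .inr (.inl (isQuotientOf_twoPowFourSymm (h.relations_snoc hB) hgen))

/-- The branching uses the exponents of `xzyz`, then `xzyzyz`, then `xyzyxz`. A fourth word is
needed only where these three are still insufficient: `xyzyzyxzyz` for exponents 6, 4, 6, and
`xyzyzyxz` for 6, 6, 5 and 6, 6, 6. -/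
theorem isQuotientOf_of_relations_six (h : Satisfies g (relations 6 []))
    (hgen : Subgroup.closure (Set.range g) = ⊤) (hA : PowEqOne (wordProd g xzyz))
    (hE : PowEqOne (wordProd g xzyzyz)) (hB : PowEqOne (wordProd g xyzyxz))
    (hF : PowEqOne (wordProd g xyzyzyxz)) (hK : PowEqOne (wordProd g xyzyzyxzyz)) :
    IsQuotientOf G (TwoPowDihedral 6) ∨ IsQuotientOf G (Cyc 2 × TwoPowSixSymm) ∨
      IsQuotientOf G ThreePowFour ∨ IsQuotientOf G SymmFourSq ∨ IsQuotientOf G AltFiveSq := by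
  have small {R : Relations} (hR : Satisfies g (relations 6 R)) {l : List (ℕ × ℕ)}
      (hl : implies (relations 6 R) [(xzyz, 4), (xzyzyz, 4)] l = true) :
      IsQuotientOf G (TwoPowDihedral 6) ∨ IsQuotientOf G (Cyc 2 × TwoPowSixSymm) ∨
      IsQuotientOf G ThreePowFour ∨ IsQuotientOf G SymmFourSq ∨ IsQuotientOf G AltFiveSq :=
    .inl (isQuotientOf_twoPowDihedralSix (hR.relations_of_implies _ hl) hgen)
  rcases hA with hA | hA | hA <;> replace h := h.relations_snoc hA
  · rcases hE with hE | hE | hE <;> replace h := h.relations_snoc hE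
    · exact .inl (isQuotientOf_twoPowDihedralSix h hgen)
    · exact small h implies_six_xzyz_four_xzyzyz_five
    · rcases hB with hB | hB | hB <;> replace h := h.relations_snoc hB
      · exact small h implies_six_xzyz_four_xzyzyz_six_xyzyxz_four
      · exact small h implies_six_xzyz_four_xzyzyz_six_xyzyxz_five
      · exact small h implies_six_xzyz_four_xzyzyz_six_xyzyxz_six
  · rcases hE with hE | hE | hE <;> replace h := h.relations_snoc hE
    · exact small h implies_six_xzyz_five_xzyzyz_four
    · exact small h implies_six_xzyz_five_xzyzyz_five
    · rcases hB with hB | hB | hB <;> replace h := h.relations_snoc hB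
      · exact small h implies_six_xzyz_five_xzyzyz_six_xyzyxz_four
      · exact small h implies_six_xzyz_five_xzyzyz_six_xyzyxz_five
      · exact .inr (.inr (.inr (.inr (isQuotientOf_altFiveSq h hgen))))
  · rcases hE with hE | hE | hE <;> replace h := h.relations_snoc hE
    · rcases hB with hB | hB | hB <;> replace h := h.relations_snoc hB
      · exact .inr (.inr (.inr (.inl (isQuotientOf_symmFourSq h hgen))))
      · exact small h implies_six_xzyz_six_xzyzyz_four_xyzyxz_five
      · rcases hK with hK | hK | hK <;> replace h := h.relations_snoc hK
        · exact small h implies_six_xzyz_six_xzyzyz_four_xyzyxz_six_xyzyzyxzyz_four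
        · exact small h implies_six_xzyz_six_xzyzyz_four_xyzyxz_six_xyzyzyxzyz_five
        · exact .inr (.inr (.inl (isQuotientOf_threePowFour h hgen)))
    · exact small h implies_six_xzyz_six_xzyzyz_five
    · rcases hB with hB | hB | hB <;> replace h := h.relations_snoc hB
      · exact small h implies_six_xzyz_six_xzyzyz_six_xyzyxz_four
      · rcases hF with hF | hF | hF <;> replace h := h.relations_snoc hF
        · exact .inr (.inl (isQuotientOf_twoPowSixSymm h hgen))
        · exact small h implies_six_xzyz_six_xzyzyz_six_xyzyxz_five_xyzyzyxz_five
        · exact small h implies_six_xzyz_six_xzyzyz_six_xyzyxz_five_xyzyzyxz_six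
      · rcases hF with hF | hF | hF <;> replace h := h.relations_snoc hF
        · exact small h implies_six_xzyz_six_xzyzyz_six_xyzyxz_six_xyzyzyxz_four
        · exact small h implies_six_xzyz_six_xzyzyz_six_xyzyxz_six_xyzyzyxz_five
        · exact small h implies_six_xzyz_six_xzyzyz_six_xyzyxz_six_xyzyzyxz_six

end

end SixTransposition

open SixTransposition in
theorem proposition3 {G : Type*} [Group G] (D : Set G) (hD : IsSixTranspositionSet D)
    (x y z : G) (hx : x ∈ D) (hy : y ∈ D) (hz : z ∈ D)
    (hgen : Subgroup.closure {x, y, z} = (⊤ : Subgroup G))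
    (r₂ : ℕ) (hr₂ : r₂ = 5 ∨ r₂ = 6)
    (hxy : (x * y) ^ 2 = 1) (hxz : (x * z) ^ 4 = 1) (hyz : (y * z) ^ r₂ = 1) :
    IsQuotientOf G (TwoPowDihedral r₂) ∨
    IsQuotientOf G (Cyc 2 × TwoPowFourSymm) ∨
    IsQuotientOf G (Cyc 2 × TwoPowSixSymm) ∨
    IsQuotientOf G ThreePowFour ∨
    IsQuotientOf G SymmFourSq ∨
    IsQuotientOf G AltFiveSq ∨
    IsQuotientOf G PGLTwoNine := by
  have hsq : ∀ a ∈ D, a * a = 1 := fun a ha => by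
    rw [← pow_two, ← hD.orderOf_eq_two a ha, pow_orderOf_eq_one]
  have hgD : ∀ s, triple x y z s ∈ D := by rintro (_ | _ | _) <;> assumption
  have hg : ∀ s, triple x y z s * triple x y z s = 1 := fun s => hsq _ (hgD s)
  have h : Satisfies (triple x y z) (relations r₂ []) := by
    refine satisfies_triple (hsq x hx) (hsq y hy) (hsq z hz) ?_
    simpa [relations, wordProd, triple] using ⟨hxy, hxz, hyz⟩
  rw [← range_triple] at hgen
  -- Each word is read as a product of two conjugates of generators: `xzyz` is `x · zyz`, and
  -- `xyzyxz` is `xyzyx · z`. The words for `r = 6` split in the same way.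
  have hA : PowEqOne (wordProd (triple x y z) xzyz) := hD.powEqOne hgD hg [] [.z] .x .y
  have hB : PowEqOne (wordProd (triple x y z) xyzyxz) := hD.powEqOne hgD hg [.x, .y] [] .z .z
  rcases hr₂ with rfl | rfl
  · have := isQuotientOf_of_relations_five h hgen hA hB
    tauto
  · have := isQuotientOf_of_relations_six h hgen hA
      (hD.powEqOne hgD hg [] [.z, .y] .x .z) hB
      (hD.powEqOne hgD hg [.x, .y, .z] [] .y .z)
      (hD.powEqOne hgD hg [.x, .y, .z] [.z] .y .y)
    tauto
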